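/- **Setting.** Equip $\mathbb{R}^{d\times r}$ with the Frobenius inner product $\langle\cdot,\cdot\rangle$ and norm $\|\cdot\|_{\mathsf F}$. Let $\mathcal M\subseteq\mathbb{R}^{d\times r}$ be a smooth embedded submanifold with a Riemannian metric $\langle\cdot,\cdot\rangle_X$ on the tangent spaces $\mathbf T_X\mathcal M$ such that, for constants $\nu,\gamma>0$, $\nu\|E\|_{\mathsf F}^2\le\langle E,E\rangle_X\le\gamma\|E\|_{\mathsf F}^2$ for all $X\in\mathcal M$, $E\in\mathbf T_X\mathcal M$. For $Z\in\mathbb{R}^{d\times r}$ let $\mathbf D(X,Z)$ be the unique element of $\mathbf T_X\mathcal M$ with $\langle\mathbf D(X,Z),E\rangle_X=\langle Z,E\rangle$ for all $E\in\mathbf T_X\mathcal M$; the Riemannian gradient of $f$ is $\mathrm{grad}\,f(X)=\mathbf D(X,\nabla f(X))$, where $\nabla f$ is the Euclidean gradient. A retraction consists of smooth maps $\mathcal R(X,\cdot):\mathbf T_X\mathcal M\to\mathcal M$, $X\in\mathcal M$, with $\mathcal R(X,0)=X$ and $\frac{d}{dt}\mathcal R(X,tE)|_{t=0}=E$. Consider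 $\min_{X\in\mathcal M}f(X)$ with $f=\frac1n\sum_{i=1}^nf_i$, $n\ge1$. Assume, with constants $L>0$, $C^{\mathcal M}\ge0$, $L_1^{\mathcal M}\ge1$, $L_2^{\mathcal M}>0$, $T_{\mathcal R}^{\mathcal M}>0$: 1. each $f_i$ is differentiable at every point of the convex hull of $\mathcal M$, and $\nabla f_i$ is $L$-Lipschitz on this convex hull; 2. $\|\nabla f_i(X)\|_{\mathsf F}\le C^{\mathcal M}$ for all $X\in\mathcal M$ and all $i$; 3. for all $X\in\mathcal M$, $E\in\mathbf T_X\mathcal M$, $t\in[0,T_{\mathcal R}^{\mathcal M}]$: $\|\mathcal R(X,tE)-X\|_{\mathsf F}\le L_1^{\mathcal M}t\|E\|_{\mathsf F}$ and $\|\mathcal R(X,tE)-X-tE\|_{\mathsf F}\le L_2^{\mathcal M}t^2\|E\|_{\mathsf F}^2$; 4. the initial point $X^{0,0}\in\mathcal M$ satisfies $f(X^{0,0})-f(X)\le D$ for all $X\in\mathcal M$. **Algorithm (S-SVRG).** Parameters: integers $S,K,|\mathsf B|\ge1$, a step size $\tau>0$, probabilities $p_0,\dots,p_K$. For $s=0,\dots,S-1$: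 compute $\nabla f(X^{s,0})$; for $k=0,\dots,K-1$, draw independently and uniformly, with replacement, a list $\mathsf B$ of $|\mathsf B|$ indices from $\{1,\dots,n\}$, set $$\mathcal G=\nabla f(X^{s,0})+\frac1{|\mathsf B|}\sum_{i\in\mathsf B}\big(\nabla f_i(X^{s,k})-\nabla f_i(X^{s,0})\big),\qquad X^{s,k+1}=\mathcal R\big(X^{s,k},-\tau\,\mathbf D(X^{s,k},\mathcal G)\big);$$ then set $X^{s+1,0}=X^{s,K}$. The output $X_r$ is $X^{s,k}$ with $s$ uniform in $\{0,\dots,S-1\}$ and $k$ of probability $p_k$, drawn independently of the mini-batches. Each evaluation of some $\nabla f_i$ is one IFO call ($n$ for each $\nabla f(X^{s,0})$ and $2|\mathsf B|$ per inner iteration), and each evaluation of $\mathcal R$ is one RO call. **Choice of parameters.** Put $\hat L^{\mathcal M}=2L_2^{\mathcal M}C^{\mathcal M}+(L_1^{\mathcal M})^2L$, $\tilde L_1^{\mathcal M}=(L_1^{\mathcal M})^2$, $\tilde L_2^{\mathcal M}=6L_1^{\mathcal M}L_2^{\mathcal M}C^{\mathcal M}$, $\tilde L^{\mathcal M}=\tilde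 L_1^{\mathcal M}+\tilde L_2^{\mathcal M}$. Let $0\le\mu\le2/3$, $\kappa>0$, and let $c\in(0,1)$ satisfy $\frac{\hat L^{\mathcal M}}{\sqrt{\tilde L^{\mathcal M}}L}\exp(c^2+2c)\,c\le1$. Put $b=\min\big\{\frac{c\nu}{\sqrt{\tilde L^{\mathcal M}}L},1,T_{\mathcal R}^{\mathcal M}\big\}$ and $$K=\big\lceil(\kappa n)^{\frac1{3(1-\mu)}}\big\rceil,\quad|\mathsf B|=\lceil K^{2-3\mu}\rceil,\quad\beta=\tfrac cbK^{\mu-1},\quad\tau=bK^{-\mu}.$$ With $\Gamma(z,i)=\frac{(1+z)^{i-1}-1}{z}$, put for $0\le k\le K-1$ $$\frac{\Delta_k}{\tau}=\nu-\frac{\hat L^{\mathcal M}}2\tau\Big[1+\Big(\frac{\tilde L_1^{\mathcal M}+\tilde L_2^{\mathcal M}K\tau}{\tilde L^{\mathcal M}}+\frac2{\tilde L^{\mathcal M}\beta\tau}\Big)\frac{\tilde L^{\mathcal M}L^2\tau^2}{\nu^2|\mathsf B|}\Gamma_k\Big],\quad\Gamma_k=\Gamma\Big(2\beta\tau+\frac{(\tilde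 L_1^{\mathcal M}+\tilde L_2^{\mathcal M}K\tau)L^2}{\nu^2|\mathsf B|}\tau^2,\,K-k\Big),$$ and $p_k=\Delta_k/\sum_{j=0}^{K-1}\Delta_j$ for $k\le K-1$, $p_K=0$. **Theorem.** The $p_k$ are nonnegative and sum to $1$. There is a constant $A>0$ depending only on $L,C^{\mathcal M},L_1^{\mathcal M},L_2^{\mathcal M},T_{\mathcal R}^{\mathcal M},\nu,\mu,\kappa,c,D$ such that for every $n\ge1$ and $\varepsilon>0$ there is a number of epochs $S\ge1$ (depending only on these constants, $n$ and $\varepsilon$) such that, for all data as above, S-SVRG with these parameters returns a stochastic $\varepsilon$-stationary point, that is, $\mathbb E\big[\|\mathrm{grad}\,f(X_r)\|_{\mathsf F}^2\big]\le\varepsilon$ with the expectation over the whole randomness of the algorithm, and every run uses $$\text{at most }A\Big(\frac{n^{2/3}}\varepsilon+n\Big)\text{ IFO calls and at most }A\Big(\frac{n^{\frac\mu{3(1-\mu)}}}\varepsilon+n^{\frac1{3(1-\mu)}}\Big)\text{ RO calls.}$$ In particular, for $\mu=0$ the bounds are $A(n^{2/3}/\varepsilon+n)$ IFO calls and $A(1/\varepsilon+n^{1/3})$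 RO calls. -/

import Mathlib

open scoped ContDiff Gradient BigOperators Topology RealInnerProductSpace

noncomputable section

namespace SSVRG

/-- The space `ℝ^{d × r}` of real matrices with the Frobenius inner product and norm. -/
abbrev Mat (d r : ℕ) := EuclideanSpace ℝ (Fin d × Fin r)

/-! ### Riemannian submanifolds of a matrix space -/

/-- `M` is a smooth embedded submanifold: near each of its points it is the zero set of a smooth
submersion. -/
def IsEmbeddedSubmanifold {d r : ℕ} (M : Set (Mat d r)) : Prop :=
  ∀ X ∈ M, ∃ (U : Set (Mat d r)) (m : ℕ) (h : Mat d r → EuclideanSpace ℝ (Fin m)),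
    IsOpen U ∧ X ∈ U ∧ ContDiffOn ℝ ∞ h U ∧
      (∀ Y ∈ U, Function.Surjective (fderiv ℝ h Y)) ∧ M ∩ U = {Y ∈ U | h Y = 0}

/-- The tangent space `T_X M`: the velocities at `X` of curves in `M` through `X`. (For an embedded
submanifold the velocities already form a linear subspace; the span only packages this.) -/
def tangentSpace {d r : ℕ} (M : Set (Mat d r)) (X : Mat d r) : Submodule ℝ (Mat d r) :=
  Submodule.span ℝ {E | ∃ γ : ℝ → Mat d r,
    γ 0 = X ∧ (∀ᶠ t in 𝓝 (0 : ℝ), γ t ∈ M) ∧ HasDerivAt γ E 0}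

/-- A submanifold of `ℝ^{d × r}` with a Riemannian metric `⟨·, ·⟩_X` on its tangent spaces.
The metric at `X` is the restriction of the bilinear form `metric X` to `T_X M`; it need not be the
one induced by the Frobenius inner product. -/
structure RiemannianSubmanifold (d r : ℕ) where
  carrier : Set (Mat d r)
  embedded : IsEmbeddedSubmanifold carrier
  metric : Mat d r → Mat d r →L[ℝ] Mat d r →L[ℝ] ℝ
  metric_smooth : ContDiffOn ℝ ∞ metric carrier
  metric_symm : ∀ X ∈ carrier, ∀ E ∈ tangentSpace carrier X, ∀ F ∈ tangentSpace carrier X,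
    metric X E F = metric X F E
  metric_pos : ∀ X ∈ carrier, ∀ E ∈ tangentSpace carrier X, E ≠ 0 → 0 < metric X E E

namespace RiemannianSubmanifold

variable {d r : ℕ}

/-- `T_X M`. -/
def tangent (M : RiemannianSubmanifold d r) (X : Mat d r) : Submodule ℝ (Mat d r) :=
  tangentSpace M.carrier X

theorem existsUnique_riesz (M : RiemannianSubmanifold d r) {X : Mat d r} (hX : X ∈ M.carrier)
    (Z : Mat d r) :
    ∃! W, W ∈ M.tangent X ∧ ∀ E ∈ M.tangent X, M.metric X W E = ⟪Z, E⟫ := by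
  let φ : M.tangent X →ₗ[ℝ] Module.Dual ℝ (M.tangent X) :=
    { toFun := fun W =>
        { toFun := fun E => M.metric X W E
          map_add' := by intro a b; simp
          map_smul' := by intro a b; simp }
      map_add' := by intro a b; ext E; simp
      map_smul' := by intro a b; ext E; simp }
  have hinj : Function.Injective φ := by
    rw [← LinearMap.ker_eq_bot, LinearMap.ker_eq_bot']
    intro W hW
    by_contra hne
    have h1 := M.metric_pos X hX W W.2 (fun h => hne (Subtype.ext h))
    have h2 : M.metric X W W = 0 := LinearMap.congr_fun hW W
    exact h1.ne' h2
  have hsurj : Function.Surjective φ :=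
    (LinearMap.injective_iff_surjective_of_finrank_eq_finrank
      (Subspace.dual_finrank_eq (K := ℝ) (V := M.tangent X)).symm).1 hinj
  obtain ⟨W, hW⟩ := hsurj ((innerₛₗ ℝ Z).comp (M.tangent X).subtype)
  refine ⟨W, ⟨W.2, fun E hE => LinearMap.congr_fun hW ⟨E, hE⟩⟩, ?_⟩
  rintro W' ⟨hW', h⟩
  have : (⟨W', hW'⟩ : M.tangent X) = W := by
    apply hinj
    rw [hW]
    ext E
    exact h E E.2
  exact congrArg Subtype.val this

open Classical in
/-- The unique `W ∈ T_X M` with `⟨W, E⟩_X = ⟨Z, E⟩` for all `E ∈ T_X M`: it turns a Euclidean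
gradient at `X ∈ M` into the Riemannian one. -/
def toRiemannian (M : RiemannianSubmanifold d r) (X Z : Mat d r) : Mat d r :=
  if hX : X ∈ M.carrier then (M.existsUnique_riesz hX Z).choose else 0

/-- The Riemannian gradient: `⟨grad f(X), E⟩_X = ⟨∇f(X), E⟩` for all `E ∈ T_X M`. -/
def grad (M : RiemannianSubmanifold d r) (f : Mat d r → ℝ) (X : Mat d r) : Mat d r :=
  M.toRiemannian X (∇ f X)

end RiemannianSubmanifold

/-- A retraction on `M`: for each `X ∈ M` a smooth map `R(X, ·) : T_X M → M` such that the curve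
`t ↦ R(X, tE)` has value `X` and velocity `E` at `t = 0`. -/
structure Retraction {d r : ℕ} (M : RiemannianSubmanifold d r) where
  toFun : Mat d r → Mat d r → Mat d r
  mem : ∀ X ∈ M.carrier, ∀ E ∈ M.tangent X, toFun X E ∈ M.carrier
  smooth : ∀ X ∈ M.carrier, ContDiffOn ℝ ∞ (toFun X) (M.tangent X : Set (Mat d r))
  zero : ∀ X ∈ M.carrier, toFun X 0 = X
  hasDerivAt : ∀ X ∈ M.carrier, ∀ E ∈ M.tangent X, HasDerivAt (fun t : ℝ => toFun X (t • E)) E 0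

/-- `f = (1/n) ∑ᵢ fᵢ`. -/
def objective {d r n : ℕ} (f : Fin n → Mat d r → ℝ) (X : Mat d r) : ℝ :=
  (1 / (n : ℝ)) * ∑ i, f i X

/-! ### The algorithm -/

/-- The stochastic variance reduced Euclidean gradient at `X` with reference point `X₀`;
`batch` lists the `B` sampled indices (repetitions allowed). -/
def svrgGradient {d r n B : ℕ} (f : Fin n → Mat d r → ℝ) (X₀ X : Mat d r)
    (batch : Fin B → Fin n) : Mat d r :=
  ∇ (objective f) X₀ + (1 / (B : ℝ)) • ∑ j, (∇ (f (batch j)) X - ∇ (f (batch j)) X₀)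

/-- The current iterate, with the numbers of component gradient evaluations (IFO calls) and of
retraction evaluations (RO calls) made so far. -/
structure State (d r : ℕ) where
  point : Mat d r
  ifo : ℕ
  ro : ℕ

/-- The states within one epoch that is entered in the state `σ`: the full gradient at `σ.point`
costs `n` component gradients, and each inner iteration costs `2B` component gradients and one
retraction. `ξ k` is the mini-batch of the inner iteration `k`. -/
def innerState {d r n B : ℕ} (M : RiemannianSubmanifold d r) (R : Retraction M)
    (f : Fin n → Mat d r → ℝ) (τ : ℝ) (σ : State d r) (ξ : ℕ → Fin B → Fin n) : ℕ → State d r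
  | 0 => { point := σ.point, ifo := σ.ifo + n, ro := σ.ro }
  | k + 1 =>
    let Y := innerState M R f τ σ ξ k
    { point := R.toFun Y.point
        (-(τ • M.toRiemannian Y.point (svrgGradient f σ.point Y.point (ξ k))))
      ifo := Y.ifo + 2 * B
      ro := Y.ro + 1 }

/-- The state after `s` epochs of `K` inner iterations; `ξ s k` is the mini-batch used in the inner
iteration `k` of the epoch `s`. -/
def outerState {d r n B : ℕ} (M : RiemannianSubmanifold d r) (R : Retraction M)
    (f : Fin n → Mat d r → ℝ) (τ : ℝ) (K : ℕ) (X₀ : Mat d r) (ξ : ℕ → ℕ → Fin B → Fin n) :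
    ℕ → State d r
  | 0 => { point := X₀, ifo := 0, ro := 0 }
  | s + 1 => innerState M R f τ (outerState M R f τ K X₀ ξ s) (ξ s) K

/-- The iterate `X^{s,k}`. -/
def iterate {d r n B : ℕ} (M : RiemannianSubmanifold d r) (R : Retraction M)
    (f : Fin n → Mat d r → ℝ) (τ : ℝ) (K : ℕ) (X₀ : Mat d r) (ξ : ℕ → ℕ → Fin B → Fin n)
    (s k : ℕ) : Mat d r :=
  (innerState M R f τ (outerState M R f τ K X₀ ξ s) (ξ s) k).point

/-- All the mini-batches of a run with `S` epochs of `K` inner iterations. The mini-batches are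
independent, and each consists of `B` independent uniform indices: the uniform distribution on this
finite type. -/
abbrev Samples (S K B n : ℕ) := Fin S → Fin K → Fin B → Fin n

/-- The mini-batches indexed by natural numbers; a run only uses those with `s < S`, `k < K`. -/
def Samples.batch {S K B n : ℕ} [NeZero n] (w : Samples S K B n) (s k : ℕ) : Fin B → Fin n :=
  if h : s < S ∧ k < K then w ⟨s, h.1⟩ ⟨k, h.2⟩ else fun _ => 0

/-- The expectation of `Φ(X_r)` over the whole randomness of the algorithm, where the output `X_r` is
`X^{s,k}` with `s` uniform in `{0, …, S-1}` and `k ∈ {0, …, K}` of probability `p k`, independently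
of the mini-batches. -/
def outputExpectation {d r n : ℕ} [NeZero n] (M : RiemannianSubmanifold d r) (R : Retraction M)
    (f : Fin n → Mat d r → ℝ) (τ : ℝ) (S K B : ℕ) (p : ℕ → ℝ) (X₀ : Mat d r)
    (Φ : Mat d r → ℝ) : ℝ :=
  (∑ w : Samples S K B n, (∑ s : Fin S, ∑ k : Fin (K + 1),
      p k * Φ (iterate M R f τ K X₀ w.batch s k)) / (S : ℝ))
    / (Fintype.card (Samples S K B n) : ℝ)

/-! ### The choice of the parameters -/

/-- The constants from which the parameters of the algorithm are computed: the Lipschitz constant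
`L` and the bound `C` of the component gradients, the constants `L₁, L₂, T` of the retraction, the
lower bound `ν` of the metric, and the free constants `μ, κ, c`. -/
structure Constants where
  (L C L₁ L₂ T ν μ κ c : ℝ)

namespace Constants

variable (P : Constants)

/-- `L̂`. -/
def Lhat : ℝ := 2 * P.L₂ * P.C + P.L₁ ^ 2 * P.L

/-- `L̃₁`. -/
def Ltilde₁ : ℝ := P.L₁ ^ 2

/-- `L̃₂`. -/
def Ltilde₂ : ℝ := 6 * P.L₁ * P.L₂ * P.C

/-- `L̃`. -/
def Ltilde : ℝ := P.L₁ ^ 2 + 6 * P.L₁ * P.L₂ * P.C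

def b : ℝ := min (P.c * P.ν / (√P.Ltilde * P.L)) (min 1 P.T)

/-- The number of inner iterations. -/
def K (n : ℕ) : ℕ := ⌈(P.κ * n) ^ (1 / (3 * (1 - P.μ)))⌉₊

/-- The mini-batch size. -/
def B (n : ℕ) : ℕ := ⌈(P.K n : ℝ) ^ (2 - 3 * P.μ)⌉₊

def β (n : ℕ) : ℝ := P.c / P.b * (P.K n : ℝ) ^ (P.μ - 1)

/-- The step size (the same in all epochs). -/
def τ (n : ℕ) : ℝ := P.b * (P.K n : ℝ) ^ (-P.μ)

/-- `Γ(z, i) = ((1 + z)^{i-1} - 1) / z`, for `i ≥ 1`. -/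
def Γ (z : ℝ) (i : ℕ) : ℝ := ((1 + z) ^ (i - 1) - 1) / z

def Γ' (n k : ℕ) : ℝ :=
  Γ (2 * P.β n * P.τ n
      + (P.Ltilde₁ + P.Ltilde₂ * P.K n * P.τ n) * P.L ^ 2 / (P.ν ^ 2 * P.B n) * P.τ n ^ 2)
    (P.K n - k)

def Δ (n k : ℕ) : ℝ :=
  P.τ n * (P.ν - P.Lhat / 2 * P.τ n *
    (1 + ((P.Ltilde₁ + P.Ltilde₂ * P.K n * P.τ n) / P.Ltilde + 2 / (P.Ltilde * P.β n * P.τ n))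
      * (P.Ltilde * P.L ^ 2 * P.τ n ^ 2 / (P.ν ^ 2 * P.B n)) * P.Γ' n k))

/-- The probability of returning the inner iterate number `k ∈ {0, …, K}` of an epoch. -/
def p (n k : ℕ) : ℝ :=
  if k < P.K n then P.Δ n k / ∑ j ∈ Finset.range (P.K n), P.Δ n j else 0

end Constants

end SSVRG

end

/-! Within an epoch with reference point `X₀ = X^{s,0}`, the potential `f(X) + w_k ‖X - X₀‖²` is
shown to decrease in expectation by at least `(ντ/2) ‖grad f(X)‖²` at each inner iteration. The
stochastic direction is `grad f(X) + e`, where `e` has mean zero over the current mini-batch and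
mean square at most `L²/(ν²|B|) ‖X - X₀‖²` (`exists_noise`). The distance term thus pays for the
variance. The smoothness of `f` along the retraction and the expansion of `‖R(X, -τD) - X₀‖²` bound
the potential after a step (`sum_potential_step_le`). The latter expansion needs an a priori bound
on `‖X - X₀‖`; it is deterministic, as every direction has norm at most `3C/ν`
(`norm_innerState_sub_le`).

The weights are a geometric sum of ratio `1 + q/K` with `q = c² + 2c`, so they grow by at most a
factor of order `exp q` over an epoch. The smallness condition on `c` and the choice of `b` are what
keeps the resulting loss below half of the gain (`weight_step`, `decrease_le`).

The distance vanishes at the start of an epoch and the weight at its end, so the potentials of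
successive epochs telescope to `f(X^{0,0}) - f ≤ D` (`sum_gradSq_le`).

The output probabilities involve other coefficients than these weights. They enter only through
`ντ/2 ≤ Δ_k ≤ ντ` (`Δ_bounds`), which makes every `p_k` at most twice the uniform probability `1/K`.
The expected squared gradient norm of the output is therefore at most `4D/(νKτS)`. Since `Kτ = b
K^{1-μ}` is at least of order `n^{1/3}` and an epoch costs `O(n)` component gradients and `K`
retractions, choosing `S` of order `1/(Kτε) + 1` gives both complexities. -/

namespace SSVRG

/-! ### Moments of mini-batch sums, the descent inequality, resampling. -/

/-- The sum over all mini-batches of the batch sums of a centred family vanishes. -/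
theorem sum_batch_sum_eq_zero {F : Type*} [NormedAddCommGroup F] [NormedSpace ℝ F] {n : ℕ} {u : Fin n → F} (hu : ∑ i, u i = 0) (B : ℕ) :
    ∑ ξ : Fin B → Fin n, ∑ j, u (ξ j) = 0 := by
  induction B with
  | zero => simp
  | succ B ih =>
    rw [← (Fin.consEquiv fun _ => Fin n).sum_comp, Fintype.sum_prod_type]
    simp [Fin.consEquiv, Fin.sum_univ_succ, Finset.sum_add_distrib, ih, ← Finset.smul_sum, hu]

section Analysis

variable {F : Type*} [NormedAddCommGroup F] [InnerProductSpace ℝ F]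

/-- The quadratic upper bound for a function whose gradient is Lipschitz on a convex set. -/
theorem le_add_inner_gradient_of_lipschitz [CompleteSpace F] {f : F → ℝ} {s : Set F} {L : ℝ}
    (hs : Convex ℝ s) (hf : ∀ x ∈ s, DifferentiableAt ℝ f x)
    (hL : ∀ x ∈ s, ∀ y ∈ s, ‖∇ f x - ∇ f y‖ ≤ L * ‖x - y‖) {x y : F} (hx : x ∈ s) (hy : y ∈ s) :
    f y ≤ f x + ⟪∇ f x, y - x⟫ + L / 2 * ‖y - x‖ ^ 2 := by
  set v := y - x with hv
  have hmem : ∀ t ∈ Set.Icc (0 : ℝ) 1, x + t • v ∈ s := fun t ht =>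
    hs.add_smul_sub_mem hx hy ht
  -- The claim is `g 1 ≤ g 0`; the Lipschitz bound between `x + t v` and `x` gives `g' ≤ 0`.
  let g : ℝ → ℝ := fun t => f (x + t • v) - t * ⟪∇ f x, v⟫ - L / 2 * t ^ 2 * ‖v‖ ^ 2
  have hg : ∀ t ∈ Set.Icc (0 : ℝ) 1, HasDerivAt g
      (⟪∇ f (x + t • v), v⟫ - ⟪∇ f x, v⟫ - L * t * ‖v‖ ^ 2) t := by
    intro t ht
    have h1 : HasDerivAt (fun t : ℝ => x + t • v) v t := by
      simpa using ((hasDerivAt_id t).smul_const v).const_add x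
    have h2 : HasDerivAt (fun t : ℝ => f (x + t • v)) ⟪∇ f (x + t • v), v⟫ t := by
      have := ((hf _ (hmem t ht)).hasGradientAt.hasFDerivAt).comp_hasDerivAt t h1
      rw [InnerProductSpace.toDual_apply_apply] at this
      exact this
    have h3 := (hasDerivAt_id t).mul_const ⟪∇ f x, v⟫
    have h4 := (((hasDerivAt_id t).pow 2).const_mul (L / 2)).mul_const (‖v‖ ^ 2)
    refine ((h2.sub h3).sub h4).congr_deriv ?_
    simp only [id, Nat.cast_ofNat, Nat.reduceSub]
    ring
  have hanti : AntitoneOn g (Set.Icc 0 1) := by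
    refine antitoneOn_of_deriv_nonpos (convex_Icc 0 1)
      (fun t ht => (hg t ht).continuousAt.continuousWithinAt)
      (fun t ht => (hg t (interior_subset ht)).differentiableAt.differentiableWithinAt) ?_
    intro t ht
    have ht' := interior_subset ht
    rw [(hg t ht').deriv, ← inner_sub_left, sub_nonpos]
    calc ⟪∇ f (x + t • v) - ∇ f x, v⟫ ≤ ‖∇ f (x + t • v) - ∇ f x‖ * ‖v‖ := real_inner_le_norm _ _
      _ ≤ L * ‖x + t • v - x‖ * ‖v‖ := by
        gcongr
        exact hL _ (hmem t ht') _ hx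
      _ = L * t * ‖v‖ ^ 2 := by
        rw [add_sub_cancel_left, norm_smul, Real.norm_of_nonneg ht'.1]
        ring
  have h := hanti (Set.left_mem_Icc.2 zero_le_one) (Set.right_mem_Icc.2 zero_le_one) zero_le_one
  simp only [g, one_smul, zero_smul, add_zero, hv, add_sub_cancel] at h
  rw [← hv] at h
  linarith

/-- The second moment of a sum of `B` independent copies of a centred family. -/
theorem sum_norm_sq_batch_sum {n : ℕ} {u : Fin n → F} (hu : ∑ i, u i = 0) (B : ℕ) :
    n * ∑ ξ : Fin B → Fin n, ‖∑ j, u (ξ j)‖ ^ 2 = B * (n : ℝ) ^ B * ∑ i, ‖u i‖ ^ 2 := by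
  induction B with
  | zero => simp
  | succ B ih =>
    rw [← (Fin.consEquiv fun _ => Fin n).sum_comp, Fintype.sum_prod_type]
    -- Splitting off the first index: the cross term is linear in the remaining batch sum, so it
    -- vanishes when summed over the batches.
    have h : ∀ (a : Fin n) (ξ : Fin B → Fin n),
        ‖∑ j, u ((Fin.consEquiv fun _ : Fin (B + 1) => Fin n) (a, ξ) j)‖ ^ 2
          = ‖u a‖ ^ 2 + 2 * ⟪u a, ∑ j, u (ξ j)⟫ + ‖∑ j, u (ξ j)‖ ^ 2 := by
      intro a ξ
      rw [← norm_add_sq_real]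
      simp [Fin.consEquiv, Fin.sum_univ_succ]
    simp only [h, Finset.sum_add_distrib, ← Finset.mul_sum, ← inner_sum,
      sum_batch_sum_eq_zero hu, inner_zero_right, Finset.sum_const, Finset.card_univ,
      Fintype.card_pi, Fintype.card_fin, Finset.prod_const, nsmul_eq_mul, Nat.cast_pow]
    rw [mul_add, mul_add, ih]
    push_cast
    ring

/-- The mean square deviation is at most the second moment. -/
theorem sum_norm_sq_sub_average_le {n : ℕ} (v : Fin n → F) :
    ∑ i, ‖v i - (1 / (n : ℝ)) • ∑ j, v j‖ ^ 2 ≤ ∑ i, ‖v i‖ ^ 2 := by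
  rcases Nat.eq_zero_or_pos n with rfl | hn
  · simp
  have hn' : (n : ℝ) ≠ 0 := by positivity
  set a := (1 / (n : ℝ)) • ∑ j, v j with ha
  have hs : ∑ j, v j = (n : ℝ) • a := by rw [ha, smul_smul, mul_one_div_cancel hn', one_smul]
  simp only [norm_sub_sq_real, Finset.sum_add_distrib, Finset.sum_sub_distrib, ← Finset.mul_sum,
    ← sum_inner, hs, real_inner_smul_left, real_inner_self_eq_norm_sq, Finset.sum_const,
    Finset.card_univ, Fintype.card_fin, nsmul_eq_mul]
  nlinarith [mul_nonneg (Nat.cast_nonneg (α := ℝ) n) (sq_nonneg ‖a‖)]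

end Analysis

/-- Resampling one coordinate of a sample `w`, which is read off by `get` and overwritten by `upd`:
sums over all samples may be compared fibrewise. -/
theorem sum_le_sum_of_resample {W β : Type*} [Fintype W] [Fintype β] (get : W → β)
    (upd : W → β → W) (get_upd : ∀ w x, get (upd w x) = x)
    (upd_upd : ∀ w x y, upd (upd w x) y = upd w y) (upd_get : ∀ w, upd w (get w) = w)
    {F H : W → ℝ} (h : ∀ w, ∑ x, F (upd w x) ≤ ∑ x, H (upd w x)) : ∑ w, F w ≤ ∑ w, H w := by
  rcases isEmpty_or_nonempty β with hβ | hβ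
  · have : IsEmpty W := ⟨fun w => hβ.false (get w)⟩
    simp
  -- A resampled uniform sample is again uniform. The map `(w, x) ↦ (upd w x, get w)`, which
  -- exchanges the old and the new coordinate, is an involution of `W × β`.
  have key : ∀ G : W → ℝ, ∑ w, ∑ x, G (upd w x) = Fintype.card β * ∑ w, G w := by
    intro G
    let σ : (W × β) ≃ (W × β) :=
      { toFun := fun a => (upd a.1 a.2, get a.1)
        invFun := fun a => (upd a.1 a.2, get a.1)
        left_inv := fun a => by simp [get_upd, upd_upd, upd_get]
        right_inv := fun a => by simp [get_upd, upd_upd, upd_get] }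
    rw [← Fintype.sum_prod_type' fun w x => G (upd w x)]
    refine (σ.sum_comp fun a => G a.1).trans ?_
    rw [Fintype.sum_prod_type]
    simp [Finset.mul_sum]
  have h' := Finset.sum_le_sum fun w (_ : w ∈ Finset.univ) => h w
  rw [key, key] at h'
  exact le_of_mul_le_mul_left h' (by exact_mod_cast Fintype.card_pos)

/-! ### The map `D(X, ·)`. -/

namespace RiemannianSubmanifold

variable {d r : ℕ} (M : RiemannianSubmanifold d r) {X : Mat d r}

theorem toRiemannian_mem (hX : X ∈ M.carrier) (Z : Mat d r) :
    M.toRiemannian X Z ∈ M.tangent X := by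
  rw [toRiemannian, dif_pos hX]
  exact (M.existsUnique_riesz hX Z).choose_spec.1.1

theorem metric_toRiemannian (hX : X ∈ M.carrier) (Z : Mat d r) {E : Mat d r}
    (hE : E ∈ M.tangent X) : M.metric X (M.toRiemannian X Z) E = ⟪Z, E⟫ := by
  rw [toRiemannian, dif_pos hX]
  exact (M.existsUnique_riesz hX Z).choose_spec.1.2 E hE

theorem toRiemannian_eq (hX : X ∈ M.carrier) {Z W : Mat d r} (hW : W ∈ M.tangent X)
    (h : ∀ E ∈ M.tangent X, M.metric X W E = ⟪Z, E⟫) : M.toRiemannian X Z = W :=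
  (M.existsUnique_riesz hX Z).unique
    ⟨M.toRiemannian_mem hX Z, fun _ hE => M.metric_toRiemannian hX Z hE⟩ ⟨hW, h⟩

/-- `Z ↦ D(X, Z)` as a linear map. -/
noncomputable def toRiemannianₗ (hX : X ∈ M.carrier) : Mat d r →ₗ[ℝ] Mat d r where
  toFun := M.toRiemannian X
  map_add' Z W := by
    refine M.toRiemannian_eq hX
      (add_mem (M.toRiemannian_mem hX Z) (M.toRiemannian_mem hX W)) fun E hE => ?_
    simp [M.metric_toRiemannian hX _ hE, inner_add_left]
  map_smul' a Z := by
    refine M.toRiemannian_eq hX (Submodule.smul_mem _ _ (M.toRiemannian_mem hX Z)) fun E hE => ?_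
    simp [M.metric_toRiemannian hX _ hE, real_inner_smul_left]

@[simp]
theorem toRiemannianₗ_apply (hX : X ∈ M.carrier) (Z : Mat d r) :
    M.toRiemannianₗ hX Z = M.toRiemannian X Z := rfl

variable {ν : ℝ}

/-- The defining identity is tested with `E = D(X, Z)`. For `Z = ∇f(X)` this is the first order
decrease along `-grad f(X)`; with Cauchy–Schwarz it gives the norm bound that follows. -/
theorem mul_norm_toRiemannian_sq_le (hX : X ∈ M.carrier)
    (hν : ∀ E ∈ M.tangent X, ν * ‖E‖ ^ 2 ≤ M.metric X E E) (Z : Mat d r) :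
    ν * ‖M.toRiemannian X Z‖ ^ 2 ≤ ⟪Z, M.toRiemannian X Z⟫ := by
  rw [← M.metric_toRiemannian hX Z (M.toRiemannian_mem hX Z)]
  exact hν _ (M.toRiemannian_mem hX Z)

theorem norm_toRiemannian_le (hν₀ : 0 < ν) (hX : X ∈ M.carrier)
    (hν : ∀ E ∈ M.tangent X, ν * ‖E‖ ^ 2 ≤ M.metric X E E) (Z : Mat d r) :
    ‖M.toRiemannian X Z‖ ≤ ‖Z‖ / ν := by
  have h := (M.mul_norm_toRiemannian_sq_le hX hν Z).trans (real_inner_le_norm _ _)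
  rcases (norm_nonneg (M.toRiemannian X Z)).eq_or_lt with h0 | h0
  · rw [← h0]
    positivity
  · rw [le_div_iff₀ hν₀]
    refine le_of_mul_le_mul_right ?_ h0
    linarith

end RiemannianSubmanifold

/-! ### One inner iteration. -/

/-- An average of `n` vectors of norm at most `C` has norm at most `C`. -/
theorem norm_average_le {F : Type*} [NormedAddCommGroup F] [NormedSpace ℝ F] {n : ℕ}
    {v : Fin n → F} {C : ℝ} (hC : 0 ≤ C) (h : ∀ i, ‖v i‖ ≤ C) :
    ‖(1 / (n : ℝ)) • ∑ i, v i‖ ≤ C := by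
  rw [norm_smul, Real.norm_of_nonneg (by positivity)]
  calc 1 / (n : ℝ) * ‖∑ i, v i‖ ≤ 1 / n * ∑ _i : Fin n, C := by
        gcongr
        exact norm_sum_le_of_le _ fun i _ => h i
    _ = (n : ℝ) / n * C := by
      simp
      ring
    _ ≤ C := mul_le_of_le_one_left hC (div_self_le_one _)

theorem hasGradientAt_objective {d r n : ℕ} {f : Fin n → Mat d r → ℝ} {X : Mat d r}
    (hf : ∀ i, DifferentiableAt ℝ (f i) X) :
    HasGradientAt (objective f) ((1 / (n : ℝ)) • ∑ i, ∇ (f i) X) X := by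
  rw [hasGradientAt_iff_hasFDerivAt, map_smul, map_sum]
  exact (HasFDerivAt.fun_sum fun i _ => (hf i).hasGradientAt.hasFDerivAt).const_mul (1 / (n : ℝ))

/-- The assumptions on the problem data, for the constants `P`. -/
structure Admissible (P : Constants) {d r n : ℕ} (M : RiemannianSubmanifold d r) (R : Retraction M)
    (f : Fin n → Mat d r → ℝ) : Prop where
  metric_ge : ∀ X ∈ M.carrier, ∀ E ∈ M.tangent X, P.ν * ‖E‖ ^ 2 ≤ M.metric X E E
  retraction : ∀ X ∈ M.carrier, ∀ E ∈ M.tangent X, ∀ t ∈ Set.Icc 0 P.T,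
    ‖R.toFun X (t • E) - X‖ ≤ P.L₁ * t * ‖E‖ ∧
      ‖R.toFun X (t • E) - X - t • E‖ ≤ P.L₂ * t ^ 2 * ‖E‖ ^ 2
  differentiable : ∀ i, ∀ X ∈ convexHull ℝ M.carrier, DifferentiableAt ℝ (f i) X
  lipschitz : ∀ i, ∀ X ∈ convexHull ℝ M.carrier, ∀ Y ∈ convexHull ℝ M.carrier,
    ‖∇ (f i) X - ∇ (f i) Y‖ ≤ P.L * ‖X - Y‖
  bounded : ∀ i, ∀ X ∈ M.carrier, ‖∇ (f i) X‖ ≤ P.C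

namespace Admissible

variable {P : Constants} {d r n B : ℕ} {M : RiemannianSubmanifold d r} {R : Retraction M}
  {f : Fin n → Mat d r → ℝ} {X X₀ E : Mat d r} {t : ℝ}

theorem gradient_objective (h : Admissible P M R f) (hX : X ∈ convexHull ℝ M.carrier) :
    ∇ (objective f) X = (1 / (n : ℝ)) • ∑ i, ∇ (f i) X :=
  (hasGradientAt_objective fun i => h.differentiable i X hX).gradient

theorem norm_gradient_objective_le (h : Admissible P M R f) (hC : 0 ≤ P.C) (hX : X ∈ M.carrier) :
    ‖∇ (objective f) X‖ ≤ P.C := by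
  rw [h.gradient_objective (subset_convexHull ℝ _ hX)]
  exact norm_average_le hC fun i => h.bounded i X hX

/-- Retraction-smoothness of the objective. -/
theorem objective_retraction_le (h : Admissible P M R f) (hL : 0 < P.L) (hC : 0 ≤ P.C)
    (hX : X ∈ M.carrier) (hE : E ∈ M.tangent X) (ht : t ∈ Set.Icc 0 P.T) :
    objective f (R.toFun X (t • E)) ≤
      objective f X + t * ⟪∇ (objective f) X, E⟫ + P.Lhat / 2 * t ^ 2 * ‖E‖ ^ 2 := by
  set Y := R.toFun X (t • E) with hY
  have hsub := subset_convexHull ℝ M.carrier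
  have hYM : Y ∈ M.carrier := R.mem X hX _ (Submodule.smul_mem _ _ hE)
  obtain ⟨h1, h2⟩ := h.retraction X hX E hE t ht
  have h3 := le_add_inner_gradient_of_lipschitz (f := objective f) (L := P.L)
    (convex_convexHull ℝ M.carrier)
    (fun x hx => (hasGradientAt_objective fun i => h.differentiable i x hx).differentiableAt)
    (fun x hx y hy => by
      rw [h.gradient_objective hx, h.gradient_objective hy, ← smul_sub, ← Finset.sum_sub_distrib]
      exact norm_average_le (by positivity) fun i => h.lipschitz i x hx y hy) (hsub hX) (hsub hYM)
  have h4 : ⟪∇ (objective f) X, Y - X⟫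
      = ⟪∇ (objective f) X, Y - X - t • E⟫ + t * ⟪∇ (objective f) X, E⟫ := by
    rw [← real_inner_smul_right, ← inner_add_right, sub_add_cancel]
  -- The second order retraction error paired with the gradient contributes `L₂ C`, and the
  -- Lipschitz term `L L₁² / 2`; their sum is `L̂ / 2`.
  have h5 : ⟪∇ (objective f) X, Y - X - t • E⟫ ≤ P.C * (P.L₂ * t ^ 2 * ‖E‖ ^ 2) :=
    (real_inner_le_norm _ _).trans
      (mul_le_mul (h.norm_gradient_objective_le hC hX) h2 (norm_nonneg _) hC)
  have h6 : P.L / 2 * ‖Y - X‖ ^ 2 ≤ P.L / 2 * (P.L₁ * t * ‖E‖) ^ 2 := by gcongr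
  rw [Constants.Lhat]
  nlinarith

/-- One retraction step changes the squared distance to a reference point by the first order term
up to a quadratic error. -/
theorem norm_retraction_sub_sq_le (h : Admissible P M R f)
    (hX : X ∈ M.carrier) (hE : E ∈ M.tangent X) (ht : t ∈ Set.Icc 0 P.T) {ρ : ℝ}
    (hρ : ‖X - X₀‖ ≤ ρ) :
    ‖R.toFun X (t • E) - X₀‖ ^ 2 ≤
      ‖X - X₀‖ ^ 2 + 2 * t * ⟪X - X₀, E⟫ + (P.L₁ ^ 2 + 2 * P.L₂ * ρ) * t ^ 2 * ‖E‖ ^ 2 := by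
  set Y := R.toFun X (t • E) with hY
  obtain ⟨h1, h2⟩ := h.retraction X hX E hE t ht
  have h3 : ‖Y - X₀‖ ^ 2 = ‖X - X₀‖ ^ 2 + 2 * ⟪X - X₀, Y - X⟫ + ‖Y - X‖ ^ 2 := by
    rw [← norm_add_sq_real]
    congr 2
    abel
  have h4 : ⟪X - X₀, Y - X⟫ = ⟪X - X₀, Y - X - t • E⟫ + t * ⟪X - X₀, E⟫ := by
    rw [← real_inner_smul_right, ← inner_add_right, sub_add_cancel]
  have h5 : ⟪X - X₀, Y - X - t • E⟫ ≤ ρ * (P.L₂ * t ^ 2 * ‖E‖ ^ 2) :=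
    (real_inner_le_norm _ _).trans
      (mul_le_mul hρ h2 (norm_nonneg _) ((norm_nonneg _).trans hρ))
  have h6 : ‖Y - X‖ ^ 2 ≤ (P.L₁ * t * ‖E‖) ^ 2 := by gcongr
  nlinarith

/-- One `C` comes from the full gradient and two from the differences. The bound holds for every
mini-batch, hence so does the bound on the distance travelled in an epoch. -/
theorem norm_svrgGradient_le (h : Admissible P M R f) (hC : 0 ≤ P.C) (hX₀ : X₀ ∈ M.carrier)
    (hX : X ∈ M.carrier) (ξ : Fin B → Fin n) : ‖svrgGradient f X₀ X ξ‖ ≤ 3 * P.C := by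
  have h1 := h.norm_gradient_objective_le hC hX₀
  have h2 : ‖(1 / (B : ℝ)) • ∑ j, (∇ (f (ξ j)) X - ∇ (f (ξ j)) X₀)‖ ≤ P.C + P.C :=
    norm_average_le (by positivity) fun j =>
      norm_sub_le_of_le (h.bounded _ X hX) (h.bounded _ X₀ hX₀)
  rw [svrgGradient]
  linarith [norm_add_le_of_le h1 h2]

/-- The Riemannian stochastic direction is the Riemannian gradient plus an average of independent
centred terms whose second moment is controlled by the distance to the reference point. -/
theorem exists_noise (h : Admissible P M R f) [NeZero n] (hν : 0 < P.ν) (hB : 0 < B)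
    (hX₀ : X₀ ∈ M.carrier) (hX : X ∈ M.carrier) :
    ∃ e : (Fin B → Fin n) → Mat d r,
      (∀ ξ, M.toRiemannian X (svrgGradient f X₀ X ξ) = M.grad (objective f) X + e ξ) ∧
      ∑ ξ, e ξ = 0 ∧
      ∑ ξ, ‖e ξ‖ ^ 2 ≤
        (n : ℝ) ^ B * (P.L ^ 2 / (P.ν ^ 2 * B) * ‖X - X₀‖ ^ 2) := by
  have hn : (0 : ℝ) < n := by exact_mod_cast NeZero.pos n
  have hB' : (0 : ℝ) < B := by exact_mod_cast hB
  have hsub := subset_convexHull ℝ M.carrier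
  let v : Fin n → Mat d r := fun i => ∇ (f i) X - ∇ (f i) X₀
  let a : Mat d r := (1 / (n : ℝ)) • ∑ i, v i
  -- Centring before applying `D(X, ·)`: by linearity the family stays centred, and `a = ∇f(X) -
  -- ∇f(X₀)` is exactly what turns the full gradient at `X₀` into the one at `X`.
  let u : Fin n → Mat d r := fun i => M.toRiemannianₗ hX (v i - a)
  have hu : ∑ i, u i = 0 := by
    have ha : ∑ i, (v i - a) = 0 := by
      rw [Finset.sum_sub_distrib, Finset.sum_const, Finset.card_univ, Fintype.card_fin,
        ← Nat.cast_smul_eq_nsmul ℝ, smul_smul, mul_one_div_cancel hn.ne', one_smul, sub_self]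
    simp only [u, ← map_sum, ha, map_zero]
  have hav : ∑ i, ‖u i‖ ^ 2 ≤ n * (P.L ^ 2 * ‖X - X₀‖ ^ 2 / P.ν ^ 2) := by
    calc ∑ i, ‖u i‖ ^ 2 ≤ ∑ i, ‖v i - a‖ ^ 2 / P.ν ^ 2 := by
          refine Finset.sum_le_sum fun i _ => ?_
          rw [← div_pow]
          gcongr
          exact M.norm_toRiemannian_le hν hX (h.metric_ge X hX) _
      _ ≤ (∑ i, ‖v i‖ ^ 2) / P.ν ^ 2 := by
          rw [← Finset.sum_div]
          refine div_le_div_of_nonneg_right ?_ (sq_nonneg _)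
          exact sum_norm_sq_sub_average_le v
      _ ≤ (∑ _i : Fin n, (P.L * ‖X - X₀‖) ^ 2) / P.ν ^ 2 := by
          gcongr with i
          exact h.lipschitz i X (hsub hX) X₀ (hsub hX₀)
      _ = n * (P.L ^ 2 * ‖X - X₀‖ ^ 2 / P.ν ^ 2) := by
          simp
          ring
  refine ⟨fun ξ => (1 / (B : ℝ)) • ∑ j, u (ξ j), fun ξ => ?_, ?_, ?_⟩
  · have hg : svrgGradient f X₀ X ξ
        = ∇ (objective f) X + (1 / (B : ℝ)) • ∑ j, (v (ξ j) - a) := by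
      rw [svrgGradient, Finset.sum_sub_distrib (f := fun j => v (ξ j)), Finset.sum_const,
        Finset.card_univ, Fintype.card_fin, ← Nat.cast_smul_eq_nsmul ℝ, smul_sub _ _ ((B : ℝ) • a),
        smul_smul, one_div_mul_cancel hB'.ne', one_smul, h.gradient_objective (hsub hX),
        h.gradient_objective (hsub hX₀)]
      simp only [a, v, Finset.sum_sub_distrib, smul_sub]
      abel
    rw [hg, ← M.toRiemannianₗ_apply hX, map_add, map_smul, map_sum]
    rfl
  · rw [← Finset.smul_sum, sum_batch_sum_eq_zero hu, smul_zero]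
  · simp only [norm_smul, mul_pow, ← Finset.mul_sum]
    rw [Real.norm_of_nonneg (by positivity)]
    have h1 := sum_norm_sq_batch_sum hu B
    have h2 : (n : ℝ) * ∑ ξ : Fin B → Fin n, ‖∑ j, u (ξ j)‖ ^ 2 ≤
        n * (B * (n : ℝ) ^ B * (P.L ^ 2 * ‖X - X₀‖ ^ 2 / P.ν ^ 2)) := by
      rw [h1]
      calc (B : ℝ) * (n : ℝ) ^ B * ∑ i, ‖u i‖ ^ 2
          ≤ B * (n : ℝ) ^ B * (n * (P.L ^ 2 * ‖X - X₀‖ ^ 2 / P.ν ^ 2)) := by gcongr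
        _ = _ := by ring
    have h3 := le_of_mul_le_mul_left h2 hn
    calc (1 / (B : ℝ)) ^ 2 * ∑ ξ : Fin B → Fin n, ‖∑ j, u (ξ j)‖ ^ 2
        ≤ (1 / (B : ℝ)) ^ 2 * (B * (n : ℝ) ^ B * (P.L ^ 2 * ‖X - X₀‖ ^ 2 / P.ν ^ 2)) := by gcongr
      _ = _ := by field_simp

/-- The expected decrease of the potential `f + w ‖· - X₀‖²` in one inner iteration. -/
theorem sum_potential_step_le (h : Admissible P M R f) [NeZero n] (hL : 0 < P.L) (hC : 0 ≤ P.C)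
    (hL₂ : 0 < P.L₂) (hν : 0 < P.ν) (hB : 0 < B) (hX₀ : X₀ ∈ M.carrier) (hX : X ∈ M.carrier)
    (ht₀ : 0 < t) (ht : t ≤ P.T) {w w' ρ Λ y β δ : ℝ} (hw : 0 ≤ w) (hβ : 0 < β)
    (hρ : ‖X - X₀‖ ≤ ρ) (hΛ : P.L₁ ^ 2 + 2 * P.L₂ * ρ = Λ)
    (hy : P.L ^ 2 * t ^ 2 / (P.ν ^ 2 * B) = y)
    (hw' : P.Lhat / 2 * y + w * (1 + β * t + Λ * y) ≤ w')
    (hδ : δ ≤ P.ν * t - P.Lhat / 2 * t ^ 2 - w * (t / β + Λ * t ^ 2)) :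
    ∑ ξ : Fin B → Fin n,
        (objective f (R.toFun X (-(t • M.toRiemannian X (svrgGradient f X₀ X ξ))))
          + w * ‖R.toFun X (-(t • M.toRiemannian X (svrgGradient f X₀ X ξ))) - X₀‖ ^ 2) ≤
      ∑ _ξ : Fin B → Fin n, (objective f X + w' * ‖X - X₀‖ ^ 2
        - δ * ‖M.grad (objective f) X‖ ^ 2) := by
  obtain ⟨e, he, he₀, he₂⟩ := h.exists_noise hν hB hX₀ hX
  set g := M.grad (objective f) X with hg
  set x := X - X₀ with hx
  have hLhat : 0 ≤ P.Lhat := by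
    rw [Constants.Lhat]
    positivity
  have hΛ₀ : 0 ≤ Λ := by
    have := (norm_nonneg _).trans hρ
    rw [← hΛ]
    positivity
  set a := P.Lhat / 2 * t ^ 2 + w * Λ * t ^ 2 with ha
  have ha₀ : 0 ≤ a := by positivity
  -- With `D = g + e ξ`, everything linear in `e ξ` is gathered in one inner product whose left
  -- factor is independent of `ξ`; it disappears in the sum over `ξ`.
  have hpt : ∀ ξ : Fin B → Fin n,
      objective f (R.toFun X (-(t • M.toRiemannian X (svrgGradient f X₀ X ξ))))
          + w * ‖R.toFun X (-(t • M.toRiemannian X (svrgGradient f X₀ X ξ))) - X₀‖ ^ 2 ≤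
        objective f X + w * ‖x‖ ^ 2
          - t * ⟪∇ (objective f) X, g⟫ - 2 * t * w * ⟪x, g⟫ + a * ‖g‖ ^ 2
          + ⟪(2 * a) • g - t • ∇ (objective f) X - (2 * t * w) • x, e ξ⟫ + a * ‖e ξ‖ ^ 2 := by
    intro ξ
    set D := M.toRiemannian X (svrgGradient f X₀ X ξ) with hD
    have hE : -D ∈ M.tangent X := neg_mem (M.toRiemannian_mem hX _)
    have h1 := h.objective_retraction_le hL hC hX hE ⟨ht₀.le, ht⟩
    have h2 := mul_le_mul_of_nonneg_left
      (h.norm_retraction_sub_sq_le hX hE ⟨ht₀.le, ht⟩ hρ) hw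
    rw [smul_neg, norm_neg, inner_neg_right] at h1 h2
    have h4 : D = g + e ξ := he ξ
    have h3 : ‖D‖ ^ 2 = ‖g‖ ^ 2 + 2 * ⟪g, e ξ⟫ + ‖e ξ‖ ^ 2 := by
      rw [h4, norm_add_sq_real]
    have h5 : ⟪∇ (objective f) X, D⟫ = ⟪∇ (objective f) X, g⟫ + ⟪∇ (objective f) X, e ξ⟫ := by
      rw [h4, inner_add_right]
    have h6 : ⟪x, D⟫ = ⟪x, g⟫ + ⟪x, e ξ⟫ := by rw [h4, inner_add_right]
    rw [inner_sub_left _ ((2 * t * w) • x), inner_sub_left ((2 * a) • g), real_inner_smul_left,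
      real_inner_smul_left, real_inner_smul_left]
    rw [← hx, hΛ, h3, h6] at h2
    rw [h3, h5] at h1
    rw [ha]
    linarith
  refine (Finset.sum_le_sum fun ξ _ => hpt ξ).trans ?_
  rw [Finset.sum_add_distrib, Finset.sum_add_distrib, ← inner_sum, he₀, inner_zero_right, add_zero,
    ← Finset.mul_sum, Finset.sum_const, Finset.sum_const, Finset.card_univ, Fintype.card_fun,
    Fintype.card_fin, Fintype.card_fin, nsmul_eq_mul, nsmul_eq_mul, Nat.cast_pow]
  have hfin : objective f X + w * ‖x‖ ^ 2
          - t * ⟪∇ (objective f) X, g⟫ - 2 * t * w * ⟪x, g⟫ + a * ‖g‖ ^ 2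
          + a * (P.L ^ 2 / (P.ν ^ 2 * B) * ‖x‖ ^ 2) ≤
      objective f X + w' * ‖x‖ ^ 2 - δ * ‖g‖ ^ 2 := by
    have h1 : P.ν * ‖g‖ ^ 2 ≤ ⟪∇ (objective f) X, g⟫ :=
      M.mul_norm_toRiemannian_sq_le hX (h.metric_ge X hX) _
    -- Young's inequality with parameter `β`: the part in `‖x‖²` feeds the next weight, the part in
    -- `‖g‖²` reduces the decrease.
    have h2 : -(2 * ⟪x, g⟫) ≤ β * ‖x‖ ^ 2 + ‖g‖ ^ 2 / β := by
      have h3 : -⟪x, g⟫ ≤ ‖x‖ * ‖g‖ := by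
        rw [← inner_neg_left, ← norm_neg x]
        exact real_inner_le_norm _ _
      have h4 : β * ‖x‖ ^ 2 + ‖g‖ ^ 2 / β - 2 * (‖x‖ * ‖g‖) = (β * ‖x‖ - ‖g‖) ^ 2 / β := by
        field_simp
        ring
      have h5 : 0 ≤ (β * ‖x‖ - ‖g‖) ^ 2 / β := by positivity
      linarith
    have h3 := mul_le_mul_of_nonneg_left h1 ht₀.le
    have h4 := mul_le_mul_of_nonneg_left h2 (mul_nonneg ht₀.le hw)
    have h5 := mul_le_mul_of_nonneg_right hw' (sq_nonneg ‖x‖)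
    have h6 := mul_le_mul_of_nonneg_right hδ (sq_nonneg ‖g‖)
    have h7 : a * (P.L ^ 2 / (P.ν ^ 2 * B) * ‖x‖ ^ 2)
        = P.Lhat / 2 * y * ‖x‖ ^ 2 + w * Λ * y * ‖x‖ ^ 2 := by
      rw [ha, ← hy]
      ring
    have h8 : t * w * (‖g‖ ^ 2 / β) = w * (t / β) * ‖g‖ ^ 2 := by ring
    rw [h7]
    rw [mul_add, h8] at h4
    rw [ha]
    linarith
  calc _ ≤ (n : ℝ) ^ B * (objective f X + w * ‖x‖ ^ 2
          - t * ⟪∇ (objective f) X, g⟫ - 2 * t * w * ⟪x, g⟫ + a * ‖g‖ ^ 2)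
          + a * ((n : ℝ) ^ B * (P.L ^ 2 / (P.ν ^ 2 * B) * ‖x‖ ^ 2)) := by gcongr
    _ = (n : ℝ) ^ B * (objective f X + w * ‖x‖ ^ 2
          - t * ⟪∇ (objective f) X, g⟫ - 2 * t * w * ⟪x, g⟫ + a * ‖g‖ ^ 2
          + a * (P.L ^ 2 / (P.ν ^ 2 * B) * ‖x‖ ^ 2)) := by ring
    _ ≤ _ := by gcongr

end Admissible
-- Estimates for the parameters.
namespace Constants

/-- The standing assumptions on the constants. -/
structure Valid (P : Constants) : Prop where
  L_pos : 0 < P.L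
  C_nonneg : 0 ≤ P.C
  one_le_L₁ : 1 ≤ P.L₁
  L₂_pos : 0 < P.L₂
  T_pos : 0 < P.T
  ν_pos : 0 < P.ν
  μ_nonneg : 0 ≤ P.μ
  μ_le : P.μ ≤ 2 / 3
  κ_pos : 0 < P.κ
  c_pos : 0 < P.c
  c_lt_one : P.c < 1
  c_small : P.Lhat / (√P.Ltilde * P.L) * Real.exp (P.c ^ 2 + 2 * P.c) * P.c ≤ 1

/-- The exponent `q = c² + 2c` of the growth of the potential over an epoch. -/
noncomputable def q (P : Constants) : ℝ := P.c ^ 2 + 2 * P.c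

/-- The factor of the squared distance to the reference point in the variance of a direction,
multiplied by `τ²`. -/
noncomputable def noise (P : Constants) (n : ℕ) : ℝ := P.L ^ 2 * P.τ n ^ 2 / (P.ν ^ 2 * P.B n)

/-- A bound for the distance of the iterates of an epoch to its reference point. -/
noncomputable def radius (P : Constants) (n : ℕ) : ℝ := P.K n * (P.L₁ * P.τ n * (3 * P.C / P.ν))

/-- The coefficient of the quadratic term in the growth of the squared distance to the reference
point. -/
noncomputable def spread (P : Constants) (n : ℕ) : ℝ := P.L₁ ^ 2 + 2 * P.L₂ * P.radius n

/-- The weight of the squared distance in the potential at the inner iteration `k`. -/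
noncomputable def weight (P : Constants) (n k : ℕ) : ℝ :=
  P.Lhat / 2 * P.noise n * ∑ i ∈ Finset.range (P.K n - k), (1 + P.q / P.K n) ^ i

/-- Partial geometric sums with ratio close to one. -/
theorem geom_sum_le_exp {q z : ℝ} {K m : ℕ} (hq : 0 < q) (hK : 0 < K) (hz₀ : 0 ≤ z)
    (hz : z ≤ q / K) (hm : m ≤ K) :
    ∑ i ∈ Finset.range m, (1 + z) ^ i ≤ K * (Real.exp q - 1) / q := by
  have hK' : (0 : ℝ) < K := by exact_mod_cast hK
  have hr : (0 : ℝ) ≤ 1 + q / K := by positivity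
  calc ∑ i ∈ Finset.range m, (1 + z) ^ i ≤ ∑ i ∈ Finset.range m, (1 + q / K) ^ i := by gcongr
    _ ≤ ∑ i ∈ Finset.range K, (1 + q / K) ^ i :=
        Finset.sum_le_sum_of_subset_of_nonneg (Finset.range_mono hm) fun i _ _ => pow_nonneg hr i
    _ = ((1 + q / K) ^ K - 1) / (1 + q / K - 1) := geom_sum_eq (by
        have : 0 < q / K := by positivity
        linarith) K
    _ ≤ (Real.exp q - 1) / (1 + q / K - 1) := by
        rw [add_sub_cancel_left]
        gcongr
        calc (1 + q / K) ^ K ≤ Real.exp (q / K) ^ K := by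
              gcongr
              rw [add_comm]
              exact Real.add_one_le_exp _
          _ = Real.exp q := by
              rw [← Real.exp_nat_mul, mul_div_cancel₀ _ hK'.ne']
    _ = K * (Real.exp q - 1) / q := by
        rw [add_sub_cancel_left]
        field_simp

namespace Valid

variable {P : Constants} {n : ℕ}

theorem q_pos (h : P.Valid) : 0 < P.q := by
  have := h.c_pos
  rw [q]
  positivity

theorem Lhat_pos (h : P.Valid) : 0 < P.Lhat := by
  have h1 := h.L_pos
  have h2 := h.C_nonneg
  have h3 := h.L₂_pos
  have h4 : 0 < P.L₁ := one_pos.trans_le h.one_le_L₁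
  rw [Lhat]
  positivity

theorem Ltilde₂_nonneg (h : P.Valid) : 0 ≤ P.Ltilde₂ := by
  have h2 := h.C_nonneg
  have h3 := h.L₂_pos
  have h4 : 0 < P.L₁ := one_pos.trans_le h.one_le_L₁
  rw [Ltilde₂]
  positivity

theorem Ltilde_eq (P : Constants) : P.Ltilde = P.Ltilde₁ + P.Ltilde₂ := rfl

theorem L₁_le_Ltilde (h : P.Valid) : P.L₁ ≤ P.Ltilde := by
  have h1 := h.Ltilde₂_nonneg
  have h2 := h.one_le_L₁
  rw [Ltilde_eq, Ltilde₁]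
  nlinarith

theorem one_le_Ltilde (h : P.Valid) : 1 ≤ P.Ltilde := h.one_le_L₁.trans h.L₁_le_Ltilde

theorem Ltilde_pos (h : P.Valid) : 0 < P.Ltilde := one_pos.trans_le h.one_le_Ltilde

theorem b_pos (h : P.Valid) : 0 < P.b := by
  have h1 := h.L_pos
  have h2 := h.ν_pos
  have h3 := h.c_pos
  have h4 := h.Ltilde_pos
  exact lt_min (by positivity) (lt_min one_pos h.T_pos)

theorem b_le_one (P : Constants) : P.b ≤ 1 := (min_le_right _ _).trans (min_le_left _ _)

theorem b_le_T (P : Constants) : P.b ≤ P.T := (min_le_right _ _).trans (min_le_right _ _)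

theorem b_mul_le (h : P.Valid) : P.b * (√P.Ltilde * P.L) ≤ P.c * P.ν := by
  have h1 := h.L_pos
  have h4 := h.Ltilde_pos
  rw [← le_div_iff₀ (by positivity)]
  exact min_le_left _ _

theorem Lhat_mul_exp_le (h : P.Valid) : P.Lhat * Real.exp P.q * P.c ≤ √P.Ltilde * P.L := by
  have h1 := h.L_pos
  have h4 := h.Ltilde_pos
  have h5 := h.c_small
  rwa [div_mul_eq_mul_div, div_mul_eq_mul_div, div_le_one (by positivity)] at h5

/-- The product of the smallness condition on `c` with `b √L̃ L ≤ cν`, after cancelling `c`. It is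
the budget for the whole loss in `half_le`. -/
theorem Lhat_mul_b_le (h : P.Valid) : P.Lhat * (P.b * Real.exp P.q) ≤ P.ν := by
  have h1 := h.L_pos
  have h4 := h.Ltilde_pos
  have h5 := mul_le_mul_of_nonneg_right h.Lhat_mul_exp_le h.b_pos.le
  have h6 : P.c * (P.Lhat * (P.b * Real.exp P.q)) ≤ P.c * P.ν := by
    linarith [h.b_mul_le]
  exact le_of_mul_le_mul_left h6 h.c_pos

theorem K_pos (h : P.Valid) (hn : 0 < n) : 0 < P.K n := by
  have := h.κ_pos
  exact Nat.ceil_pos.2 (by positivity)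

theorem one_le_K (h : P.Valid) (hn : 0 < n) : (1 : ℝ) ≤ P.K n := by
  exact_mod_cast h.K_pos hn

theorem one_le_K_rpow (h : P.Valid) (hn : 0 < n) : 1 ≤ (P.K n : ℝ) ^ P.μ :=
  Real.one_le_rpow (h.one_le_K hn) h.μ_nonneg

theorem K_rpow_le (h : P.Valid) (hn : 0 < n) : (P.K n : ℝ) ^ P.μ ≤ P.K n := by
  have := h.μ_le
  simpa using Real.rpow_le_rpow_of_exponent_le (h.one_le_K hn) (show P.μ ≤ 1 by linarith)

/-- All powers of `K` are reduced to `K` and `K^μ`, where `1 ≤ K^μ ≤ K`; the estimates below then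
become rational in these two quantities. -/
theorem τ_eq (P : Constants) (n : ℕ) : P.τ n = P.b / (P.K n : ℝ) ^ P.μ := by
  rw [τ, Real.rpow_neg (Nat.cast_nonneg _), div_eq_mul_inv]

theorem β_eq (h : P.Valid) (hn : 0 < n) :
    P.β n = P.c / P.b * ((P.K n : ℝ) ^ P.μ / P.K n) := by
  rw [β, Real.rpow_sub_one (one_pos.trans_le (h.one_le_K hn)).ne']

theorem K_rpow_eq (h : P.Valid) (hn : 0 < n) :
    (P.K n : ℝ) ^ (2 - 3 * P.μ) = (P.K n : ℝ) ^ 2 / ((P.K n : ℝ) ^ P.μ) ^ 3 := by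
  have hK := one_pos.trans_le (h.one_le_K hn)
  rw [Real.rpow_sub hK, mul_comm 3, Real.rpow_mul hK.le]
  norm_cast

theorem τ_pos (h : P.Valid) (hn : 0 < n) : 0 < P.τ n := by
  have h1 := h.b_pos
  have h2 := one_pos.trans_le (h.one_le_K_rpow hn)
  rw [τ_eq]
  positivity

theorem β_pos (h : P.Valid) (hn : 0 < n) : 0 < P.β n := by
  have h1 := h.b_pos
  have h2 := one_pos.trans_le (h.one_le_K_rpow hn)
  have h3 := one_pos.trans_le (h.one_le_K hn)
  have h4 := h.c_pos
  rw [h.β_eq hn]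
  positivity

theorem τ_le_b (h : P.Valid) (hn : 0 < n) : P.τ n ≤ P.b := by
  rw [τ_eq]
  exact div_le_self h.b_pos.le (h.one_le_K_rpow hn)

theorem τ_le_T (h : P.Valid) (hn : 0 < n) : P.τ n ≤ P.T := (h.τ_le_b hn).trans (b_le_T P)

theorem β_mul_τ (h : P.Valid) (hn : 0 < n) : P.β n * P.τ n = P.c / P.K n := by
  have h1 := h.b_pos
  have h2 := one_pos.trans_le (h.one_le_K_rpow hn)
  have h3 := one_pos.trans_le (h.one_le_K hn)
  rw [h.β_eq hn, τ_eq]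
  field_simp

theorem B_pos (h : P.Valid) (hn : 0 < n) : 0 < P.B n := by
  have := one_pos.trans_le (h.one_le_K hn)
  exact Nat.ceil_pos.2 (by positivity)

theorem noise_nonneg (P : Constants) (n : ℕ) : 0 ≤ P.noise n := by
  rw [noise]
  positivity

/-- The batch size `|B| ≥ K^{2-3μ}` together with `τ = b K^{-μ}` leaves `K^{μ-2}`, and `b √L̃ L ≤
cν` turns the constant into `c²`. -/
theorem noise_le (h : P.Valid) (hn : 0 < n) :
    P.Ltilde * P.noise n ≤ P.c ^ 2 * ((P.K n : ℝ) ^ P.μ / (P.K n : ℝ) ^ 2) := by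
  have h1 := h.b_pos
  have h2 := one_pos.trans_le (h.one_le_K_rpow hn)
  have h3 := one_pos.trans_le (h.one_le_K hn)
  have h4 := h.ν_pos
  have h5 := h.L_pos
  have h6 := h.Ltilde_pos
  have hB : (P.K n : ℝ) ^ 2 / ((P.K n : ℝ) ^ P.μ) ^ 3 ≤ P.B n := by
    rw [← h.K_rpow_eq hn]
    exact Nat.le_ceil _
  have h7 : P.Ltilde * (P.L ^ 2 * P.b ^ 2) ≤ P.c ^ 2 * P.ν ^ 2 := by
    have := pow_le_pow_left₀ (by positivity) h.b_mul_le 2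
    rw [mul_pow, mul_pow, mul_pow, Real.sq_sqrt h6.le] at this
    linarith
  set a := (P.K n : ℝ) ^ P.μ
  calc P.Ltilde * P.noise n
      ≤ P.Ltilde * (P.L ^ 2 * P.τ n ^ 2 / (P.ν ^ 2 * ((P.K n : ℝ) ^ 2 / a ^ 3))) := by
        rw [noise]
        gcongr
    _ = P.Ltilde * (P.L ^ 2 * P.b ^ 2) * (a / ((P.K n : ℝ) ^ 2 * P.ν ^ 2)) := by
        rw [show P.τ n = P.b / a from τ_eq P n]
        field_simp
    _ ≤ P.c ^ 2 * P.ν ^ 2 * (a / ((P.K n : ℝ) ^ 2 * P.ν ^ 2)) := by gcongr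
    _ = _ := by field_simp

/-- If a drift coefficient is at most `s L̃ K^{1-μ}`, then it contributes at most `c² s / K` to the
growth rate of the potential. -/
theorem noise_mul_le (h : P.Valid) (hn : 0 < n) {Λ s : ℝ} (hs : 0 ≤ s)
    (hΛ : Λ ≤ s * P.Ltilde * (P.K n / (P.K n : ℝ) ^ P.μ)) :
    P.noise n * Λ ≤ P.c ^ 2 * s / P.K n := by
  have h2 := one_pos.trans_le (h.one_le_K_rpow hn)
  have h3 := one_pos.trans_le (h.one_le_K hn)
  calc P.noise n * Λ ≤ P.noise n * (s * P.Ltilde * (P.K n / (P.K n : ℝ) ^ P.μ)) :=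
        mul_le_mul_of_nonneg_left hΛ (noise_nonneg P n)
    _ = P.Ltilde * P.noise n * (s * (P.K n / (P.K n : ℝ) ^ P.μ)) := by ring
    _ ≤ P.c ^ 2 * ((P.K n : ℝ) ^ P.μ / (P.K n : ℝ) ^ 2) * (s * (P.K n / (P.K n : ℝ) ^ P.μ)) := by
        refine mul_le_mul_of_nonneg_right (h.noise_le hn) (by positivity)
    _ = _ := by field_simp

theorem noise_mul_Ltilde_le (h : P.Valid) (hn : 0 < n) :
    P.noise n * (P.Ltilde₁ + P.Ltilde₂ * P.K n * P.τ n) ≤ P.c ^ 2 / P.K n := by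
  have h2 := one_pos.trans_le (h.one_le_K_rpow hn)
  have h3 := one_pos.trans_le (h.one_le_K hn)
  have h4 : 1 ≤ P.K n / (P.K n : ℝ) ^ P.μ := (one_le_div h2).2 (h.K_rpow_le hn)
  have h5 := h.Ltilde₂_nonneg
  have := h.noise_mul_le hn (Λ := P.Ltilde₁ + P.Ltilde₂ * P.K n * P.τ n) zero_le_one (by
    rw [τ_eq, one_mul, Ltilde_eq, add_mul]
    refine add_le_add (le_mul_of_one_le_right (sq_nonneg _) h4) ?_
    calc P.Ltilde₂ * P.K n * (P.b / (P.K n : ℝ) ^ P.μ)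
        ≤ P.Ltilde₂ * P.K n * (1 / (P.K n : ℝ) ^ P.μ) := by
          gcongr
          exact b_le_one P
      _ = _ := by ring)
  rwa [mul_one] at this

theorem spread_eq (P : Constants) (n : ℕ) :
    P.spread n = P.Ltilde₁ + P.Ltilde₂ * (P.b / P.ν) * (P.K n / (P.K n : ℝ) ^ P.μ) := by
  rw [spread, radius, τ_eq, Ltilde₁, Ltilde₂]
  ring

/-- The distance bound of an epoch carries a factor `1/ν` that is absent from `L̃₂`; here `b/ν ≤
c/(√L̃ L)` and the smallness of `c` absorb it at the price of `1/c`. -/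
theorem Ltilde₂_mul_le (h : P.Valid) : P.Ltilde₂ * (P.b / P.ν) ≤ P.Ltilde / P.c := by
  have hL := h.L_pos
  have hLt := h.Ltilde_pos
  have hc := h.c_pos
  have hν := h.ν_pos
  have h1 : 0 < P.L₁ := one_pos.trans_le h.one_le_L₁
  have hs : 0 < √P.Ltilde * P.L := by positivity
  -- From `exp q ≥ 1 + 2c + c²` and `c < 1`. The `3` is the one in `L̃₂ = 3 · L₁ · (2 L₂ C)`.
  have h2 : 3 * P.c ≤ Real.exp P.q := by
    have := Real.add_one_le_exp P.q
    have h3 := h.c_lt_one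
    rw [q] at this ⊢
    nlinarith [sq_nonneg P.c]
  have h3 : 2 * P.L₂ * P.C ≤ P.Lhat := by
    rw [Lhat]
    have : 0 ≤ P.L₁ ^ 2 * P.L := by positivity
    linarith
  have h4 : P.Ltilde₂ * P.c ^ 2 ≤ P.Ltilde * (√P.Ltilde * P.L) := by
    have h5 : 0 ≤ 2 * P.L₂ * P.C := by
      have := h.L₂_pos
      have := h.C_nonneg
      positivity
    calc P.Ltilde₂ * P.c ^ 2 = P.L₁ * (2 * P.L₂ * P.C * (3 * P.c) * P.c) := by
          rw [Ltilde₂]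
          ring
      _ ≤ P.L₁ * (P.Lhat * Real.exp P.q * P.c) := by
          have := h.Lhat_pos
          gcongr
      _ ≤ P.L₁ * (√P.Ltilde * P.L) := mul_le_mul_of_nonneg_left h.Lhat_mul_exp_le h1.le
      _ ≤ _ := by
          gcongr
          exact h.L₁_le_Ltilde
  calc P.Ltilde₂ * (P.b / P.ν) ≤ P.Ltilde₂ * (P.c / (√P.Ltilde * P.L)) := by
        refine mul_le_mul_of_nonneg_left ?_ h.Ltilde₂_nonneg
        rw [div_le_div_iff₀ hν hs]
        exact h.b_mul_le
    _ ≤ P.Ltilde / P.c := by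
        rw [mul_div_assoc', div_le_div_iff₀ hs hc]
        linarith

theorem noise_mul_spread_le (h : P.Valid) (hn : 0 < n) :
    P.noise n * P.spread n ≤ (P.c ^ 2 + P.c) / P.K n := by
  have h2 := one_pos.trans_le (h.one_le_K_rpow hn)
  have hc := h.c_pos
  have h4 : 1 ≤ P.K n / (P.K n : ℝ) ^ P.μ := (one_le_div h2).2 (h.K_rpow_le hn)
  have h5 := h.Ltilde₂_nonneg
  -- The factor `s = 1 + 1/c` turns `c²` into `c² + c`. The additional `c` is affordable because the
  -- growth rate of the potential contains `βτ = c/K` once, while the one in `Γ_k` contains it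
  -- twice; both add up to at most `q/K`.
  have := h.noise_mul_le hn (Λ := P.spread n) (s := 1 + 1 / P.c) (by positivity) (by
    rw [spread_eq]
    calc P.Ltilde₁ + P.Ltilde₂ * (P.b / P.ν) * (P.K n / (P.K n : ℝ) ^ P.μ)
        ≤ P.Ltilde * (P.K n / (P.K n : ℝ) ^ P.μ)
          + P.Ltilde / P.c * (P.K n / (P.K n : ℝ) ^ P.μ) := by
          refine add_le_add ?_ (mul_le_mul_of_nonneg_right h.Ltilde₂_mul_le (by linarith))
          refine le_trans ?_ (le_mul_of_one_le_right h.Ltilde_pos.le h4)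
          rw [Ltilde_eq]
          linarith
      _ = _ := by ring)
  convert this using 2
  field_simp

theorem noise_div_le (h : P.Valid) (hn : 0 < n) :
    P.noise n * (1 / (P.β n * P.τ n)) ≤ P.c * ((P.K n : ℝ) ^ P.μ / P.K n) := by
  have h2 := one_pos.trans_le (h.one_le_K_rpow hn)
  have h3 := one_pos.trans_le (h.one_le_K hn)
  have hc := h.c_pos
  have h5 : P.noise n ≤ P.c ^ 2 * ((P.K n : ℝ) ^ P.μ / (P.K n : ℝ) ^ 2) :=
    (le_mul_of_one_le_left (noise_nonneg P n) h.one_le_Ltilde).trans (h.noise_le hn)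
  rw [h.β_mul_τ hn]
  calc P.noise n * (1 / (P.c / P.K n))
      ≤ P.c ^ 2 * ((P.K n : ℝ) ^ P.μ / (P.K n : ℝ) ^ 2) * (1 / (P.c / P.K n)) := by gcongr
    _ = _ := by field_simp

/-- The step size is small enough for a decrease of at least `ντ / 2`. -/
theorem half_le (h : P.Valid) (hn : 0 < n) {W g : ℝ} (hg₀ : 0 ≤ g)
    (hW : W ≤ P.q * ((P.K n : ℝ) ^ P.μ / P.K n))
    (hg : g ≤ P.K n * (Real.exp P.q - 1) / P.q) :
    P.Lhat / 2 * P.τ n * (1 + W * g) ≤ P.ν / 2 := by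
  have h1 := one_pos.trans_le (h.one_le_K_rpow hn)
  have h2 := one_pos.trans_le (h.one_le_K hn)
  have h3 := h.q_pos
  have h4 := h.Lhat_pos
  have h5 := h.τ_pos hn
  calc P.Lhat / 2 * P.τ n * (1 + W * g)
      ≤ P.Lhat / 2 * P.τ n * (1 + P.q * ((P.K n : ℝ) ^ P.μ / P.K n)
          * (P.K n * (Real.exp P.q - 1) / P.q)) := by
        gcongr
    -- The powers of `K` cancel: `τ K^μ = b`.
    _ = P.Lhat / 2 * (P.τ n + P.b * (Real.exp P.q - 1)) := by
        rw [τ_eq]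
        field_simp
    _ ≤ P.Lhat / 2 * (P.b + P.b * (Real.exp P.q - 1)) := by
        gcongr
        exact h.τ_le_b hn
    _ = P.Lhat * (P.b * Real.exp P.q) / 2 := by ring
    _ ≤ P.ν / 2 := by linarith [h.Lhat_mul_b_le]

theorem div_K_le (h : P.Valid) (hn : 0 < n) {a : ℝ} (ha : 0 ≤ a) :
    a / P.K n ≤ a * ((P.K n : ℝ) ^ P.μ / P.K n) := by
  rw [mul_div_assoc']
  exact div_le_div_of_nonneg_right (le_mul_of_one_le_right ha (h.one_le_K_rpow hn))
    (Nat.cast_nonneg _)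

theorem weight_nonneg (h : P.Valid) (n k : ℕ) : 0 ≤ P.weight n k := by
  have h1 := h.Lhat_pos
  have h2 := noise_nonneg P n
  have h3 := h.q_pos
  rw [weight]
  positivity

theorem weight_self (P : Constants) (n : ℕ) : P.weight n (P.K n) = 0 := by simp [weight]

/-- The weights satisfy the recursion with rate `q/K` exactly, and the true growth rate `βτ + spread
· noise` is at most `c/K + (c² + c)/K = q/K`. -/
theorem weight_step (h : P.Valid) (hn : 0 < n) {k : ℕ} (hk : k < P.K n) :
    P.Lhat / 2 * P.noise n
      + P.weight n (k + 1) * (1 + P.β n * P.τ n + P.spread n * P.noise n) ≤ P.weight n k := by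
  have h1 : P.β n * P.τ n + P.spread n * P.noise n ≤ P.q / P.K n := by
    have := h.noise_mul_spread_le hn
    calc P.β n * P.τ n + P.spread n * P.noise n ≤ P.c / P.K n + (P.c ^ 2 + P.c) / P.K n := by
          rw [h.β_mul_τ hn, mul_comm (P.spread n)]
          gcongr
      _ = P.q / P.K n := by
          rw [q]
          ring
  have h2 := mul_le_mul_of_nonneg_left h1 (h.weight_nonneg n (k + 1))
  have h3 : P.weight n k
      = P.Lhat / 2 * P.noise n + P.weight n (k + 1) * (1 + P.q / P.K n) := by
    rw [weight, weight, show P.K n - k = P.K n - (k + 1) + 1 by omega, geom_sum_succ]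
    ring
  rw [h3]
  linarith

theorem decrease_le (h : P.Valid) (hn : 0 < n) (k : ℕ) :
    P.ν * P.τ n / 2 ≤ P.ν * P.τ n - P.Lhat / 2 * P.τ n ^ 2
      - P.weight n (k + 1) * (P.τ n / P.β n + P.spread n * P.τ n ^ 2) := by
  have hβ := h.β_pos hn
  have hτ := h.τ_pos hn
  have hc := h.c_pos
  have hq := h.q_pos
  set g := ∑ i ∈ Finset.range (P.K n - (k + 1)), (1 + P.q / P.K n) ^ i with hg
  have hg₀ : 0 ≤ g := by positivity
  have hgle : g ≤ P.K n * (Real.exp P.q - 1) / P.q :=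
    geom_sum_le_exp hq (h.K_pos hn) (by positivity) le_rfl (by omega)
  have hW : P.noise n * (1 / (P.β n * P.τ n) + P.spread n)
      ≤ P.q * ((P.K n : ℝ) ^ P.μ / P.K n) := by
    rw [mul_add]
    calc _ ≤ P.c * ((P.K n : ℝ) ^ P.μ / P.K n) + (P.c ^ 2 + P.c) * ((P.K n : ℝ) ^ P.μ / P.K n) :=
          add_le_add (h.noise_div_le hn)
            ((h.noise_mul_spread_le hn).trans (h.div_K_le hn (by positivity)))
      _ = _ := by
          rw [q]
          ring
  have h1 := mul_le_mul_of_nonneg_left (h.half_le hn hg₀ hW hgle) hτ.le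
  have h2 : P.weight n (k + 1) * (P.τ n / P.β n + P.spread n * P.τ n ^ 2)
      = P.τ n * (P.Lhat / 2 * P.τ n
        * (P.noise n * (1 / (P.β n * P.τ n) + P.spread n) * g)) := by
    rw [weight, ← hg]
    field_simp
  rw [h2]
  linarith

theorem Γ_eq {z : ℝ} (hz : z ≠ 0) (i : ℕ) : Γ z i = ∑ j ∈ Finset.range (i - 1), (1 + z) ^ j := by
  rw [geom_sum_eq (by simpa using hz), Γ, add_sub_cancel_left]

/-- The loss in `Δ_k` has the form treated by `half_le`, with `W = noise · (2/(βτ) + Λ)` and `Γ_k` a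
geometric sum of `K - k - 1` terms of ratio at most `1 + q/K`. -/
theorem Δ_bounds (h : P.Valid) (hn : 0 < n) (k : ℕ) :
    P.ν * P.τ n / 2 ≤ P.Δ n k ∧ P.Δ n k ≤ P.ν * P.τ n := by
  have hβ := h.β_pos hn
  have hτ := h.τ_pos hn
  have hc := h.c_pos
  have hq := h.q_pos
  have hLt := h.Ltilde_pos
  have hLhat := h.Lhat_pos
  have hν := h.ν_pos
  have hnoise := noise_nonneg P n
  have hK := one_pos.trans_le (h.one_le_K hn)
  have hΛ₀ : 0 ≤ P.Ltilde₁ + P.Ltilde₂ * P.K n * P.τ n := by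
    have := h.Ltilde₂_nonneg
    rw [Ltilde₁]
    positivity
  set Λ := P.Ltilde₁ + P.Ltilde₂ * P.K n * P.τ n with hΛ
  set z := 2 * P.β n * P.τ n + P.noise n * Λ with hz
  have hz₀ : 0 < z := by positivity
  have hzle : z ≤ P.q / P.K n := by
    calc z = 2 * (P.β n * P.τ n) + P.noise n * Λ := by rw [hz]; ring
      _ ≤ 2 * (P.c / P.K n) + P.c ^ 2 / P.K n := by
          rw [h.β_mul_τ hn]
          exact add_le_add le_rfl (h.noise_mul_Ltilde_le hn)
      _ = P.q / P.K n := by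
          rw [q]
          ring
  set g := P.Γ' n k with hg
  have hgz : g = ∑ j ∈ Finset.range (P.K n - k - 1), (1 + z) ^ j := by
    rw [hg, Γ', ← Γ_eq hz₀.ne', hz, noise]
    congr 1
    ring
  have hg₀ : 0 ≤ g := by
    rw [hgz]
    positivity
  have hgle : g ≤ P.K n * (Real.exp P.q - 1) / P.q := by
    rw [hgz]
    exact geom_sum_le_exp hq (h.K_pos hn) hz₀.le hzle (by omega)
  set W := P.noise n * (2 / (P.β n * P.τ n) + Λ) with hWdef
  have hW₀ : 0 ≤ W := by positivity
  have hW : W ≤ P.q * ((P.K n : ℝ) ^ P.μ / P.K n) := by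
    calc W = 2 * (P.noise n * (1 / (P.β n * P.τ n))) + P.noise n * Λ := by
          rw [hWdef]
          ring
      _ ≤ 2 * (P.c * ((P.K n : ℝ) ^ P.μ / P.K n)) + P.c ^ 2 * ((P.K n : ℝ) ^ P.μ / P.K n) :=
          add_le_add (mul_le_mul_of_nonneg_left (h.noise_div_le hn) two_pos.le)
            ((h.noise_mul_Ltilde_le hn).trans (h.div_K_le hn (by positivity)))
      _ = _ := by
          rw [q]
          ring
  have hΔ : P.Δ n k = P.τ n * (P.ν - P.Lhat / 2 * P.τ n * (1 + W * g)) := by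
    rw [Δ, ← hΛ, ← hg, hWdef, noise]
    congr 5
    field_simp
    ring
  have h1 := mul_le_mul_of_nonneg_left (h.half_le hn hg₀ hW hgle) hτ.le
  have h2 : 0 ≤ P.τ n * (P.Lhat / 2 * P.τ n * (1 + W * g)) := by positivity
  rw [hΔ]
  constructor <;> linarith

theorem sum_Δ_ge (h : P.Valid) (hn : 0 < n) :
    P.K n * (P.ν * P.τ n / 2) ≤ ∑ j ∈ Finset.range (P.K n), P.Δ n j := by
  have := Finset.card_nsmul_le_sum (Finset.range (P.K n)) (P.Δ n) _
    fun k _ => (h.Δ_bounds hn k).1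
  simpa using this

theorem sum_Δ_pos (h : P.Valid) (hn : 0 < n) : 0 < ∑ j ∈ Finset.range (P.K n), P.Δ n j := by
  have hK := one_pos.trans_le (h.one_le_K hn)
  have hτ := h.τ_pos hn
  have hν := h.ν_pos
  exact lt_of_lt_of_le (by positivity) (h.sum_Δ_ge hn)

theorem p_nonneg (h : P.Valid) (hn : 0 < n) (k : ℕ) : 0 ≤ P.p n k := by
  have hτ := h.τ_pos hn
  have hν := h.ν_pos
  rw [p]
  split_ifs
  · exact div_nonneg (le_trans (by positivity) (h.Δ_bounds hn k).1) (h.sum_Δ_pos hn).le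
  · exact le_rfl

theorem sum_p (h : P.Valid) (hn : 0 < n) : ∑ k ∈ Finset.range (P.K n + 1), P.p n k = 1 := by
  have h1 : ∀ k ∈ Finset.range (P.K n),
      P.p n k = P.Δ n k / ∑ j ∈ Finset.range (P.K n), P.Δ n j :=
    fun k hk => if_pos (Finset.mem_range.1 hk)
  have h2 : P.p n (P.K n) = 0 := if_neg (lt_irrefl _)
  rw [Finset.sum_range_succ, h2, add_zero, Finset.sum_congr rfl h1, ← Finset.sum_div,
    div_self (h.sum_Δ_pos hn).ne']

theorem p_le (h : P.Valid) (hn : 0 < n) (k : ℕ) : P.p n k ≤ 2 / P.K n := by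
  have hK := one_pos.trans_le (h.one_le_K hn)
  have hτ := h.τ_pos hn
  have hν := h.ν_pos
  rw [p]
  split_ifs
  · rw [div_le_div_iff₀ (h.sum_Δ_pos hn) hK]
    have h1 := mul_le_mul_of_nonneg_right (h.Δ_bounds hn k).2 hK.le
    linarith [h.sum_Δ_ge hn]
  · positivity

end Valid
end Constants
-- Measurability, feasibility and oracle counts of the iterates.
section Iterates

variable {d r n B : ℕ} {M : RiemannianSubmanifold d r} {R : Retraction M}
  {f : Fin n → Mat d r → ℝ} {τ : ℝ}

theorem innerState_congr (σ : State d r) {ξ ξ' : ℕ → Fin B → Fin n} {k : ℕ}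
    (h : ∀ j < k, ξ j = ξ' j) : innerState M R f τ σ ξ k = innerState M R f τ σ ξ' k := by
  induction k with
  | zero => rfl
  | succ k ih =>
    simp only [innerState]
    rw [ih fun j hj => h j (by omega), h k (by omega)]

theorem outerState_congr {K : ℕ} (X₀ : Mat d r) {ξ ξ' : ℕ → ℕ → Fin B → Fin n} {s : ℕ}
    (h : ∀ i < s, ∀ j < K, ξ i j = ξ' i j) :
    outerState M R f τ K X₀ ξ s = outerState M R f τ K X₀ ξ' s := by
  induction s with
  | zero => rfl
  | succ s ih =>
    simp only [outerState]
    rw [ih fun i hi => h i (by omega), innerState_congr _ (h s (by omega))]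

theorem innerState_point_mem {σ : State d r} (hσ : σ.point ∈ M.carrier) (ξ : ℕ → Fin B → Fin n)
    (k : ℕ) : (innerState M R f τ σ ξ k).point ∈ M.carrier := by
  induction k with
  | zero => exact hσ
  | succ k ih =>
    exact R.mem _ ih _ (neg_mem (Submodule.smul_mem _ _ (M.toRiemannian_mem ih _)))

theorem outerState_point_mem {K : ℕ} {X₀ : Mat d r} (hX₀ : X₀ ∈ M.carrier)
    (ξ : ℕ → ℕ → Fin B → Fin n) (s : ℕ) :
    (outerState M R f τ K X₀ ξ s).point ∈ M.carrier := by
  induction s with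
  | zero => exact hX₀
  | succ s ih => exact innerState_point_mem ih _ _

theorem innerState_calls (σ : State d r) (ξ : ℕ → Fin B → Fin n) (k : ℕ) :
    (innerState M R f τ σ ξ k).ifo = σ.ifo + n + k * (2 * B) ∧
      (innerState M R f τ σ ξ k).ro = σ.ro + k := by
  induction k with
  | zero => simp [innerState]
  | succ k ih =>
    simp only [innerState, ih]
    constructor <;> ring

theorem outerState_calls {K : ℕ} (X₀ : Mat d r) (ξ : ℕ → ℕ → Fin B → Fin n) (s : ℕ) :
    (outerState M R f τ K X₀ ξ s).ifo = s * (n + K * (2 * B)) ∧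
      (outerState M R f τ K X₀ ξ s).ro = s * K := by
  induction s with
  | zero => simp [outerState]
  | succ s ih =>
    simp only [outerState, innerState_calls, ih]
    constructor <;> ring

end Iterates

/-- Overwriting the mini-batch of the inner iteration `k` of the epoch `s`. -/
def Samples.update {S K B n : ℕ} (s : Fin S) (k : Fin K) (w : Samples S K B n)
    (ξ : Fin B → Fin n) : Samples S K B n :=
  Function.update w s (Function.update (w s) k ξ)

theorem Samples.batch_update_of_ne {S K B n : ℕ} [NeZero n] {s : Fin S} {k : Fin K}
    (w : Samples S K B n) (ξ : Fin B → Fin n) {i j : ℕ} (h : i ≠ s ∨ j ≠ k) :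
    (Samples.update s k w ξ).batch i j = w.batch i j := by
  rw [Samples.batch, Samples.batch]
  split_ifs with hij
  · rw [Samples.update]
    by_cases hi : (⟨i, hij.1⟩ : Fin S) = s
    · have hj : (⟨j, hij.2⟩ : Fin K) ≠ k := by
        rintro rfl
        rcases h with h | h
        · exact h (congrArg Fin.val hi)
        · exact h rfl
      subst hi
      rw [Function.update_self, Function.update_of_ne hj]
    · rw [Function.update_of_ne hi]
  · rfl

theorem Samples.batch_update_self {S K B n : ℕ} [NeZero n] {s : Fin S} {k : Fin K}
    (w : Samples S K B n) (ξ : Fin B → Fin n) : (Samples.update s k w ξ).batch s k = ξ := by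
  rw [Samples.batch, dif_pos ⟨s.2, k.2⟩]
  simp [Samples.update]

/-! ### Expected decrease over the whole run. -/

namespace Admissible

open Constants

variable {P : Constants} {d r n : ℕ} {M : RiemannianSubmanifold d r} {R : Retraction M}
  {f : Fin n → Mat d r → ℝ} {X₀ : Mat d r}

/-- The iterates of an epoch stay close to its reference point. -/
theorem norm_innerState_sub_le (h : Admissible P M R f) (hP : P.Valid) (hn : 0 < n) {B : ℕ}
    {σ : State d r} (hσ : σ.point ∈ M.carrier) (ξ : ℕ → Fin B → Fin n) (k : ℕ) :
    ‖(innerState M R f (P.τ n) σ ξ k).point - σ.point‖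
      ≤ k * (P.L₁ * P.τ n * (3 * P.C / P.ν)) := by
  have hτ := hP.τ_pos hn
  have hν := hP.ν_pos
  have hL₁ := one_pos.trans_le hP.one_le_L₁
  induction k with
  | zero => simp [innerState]
  | succ k ih =>
    set Y := (innerState M R f (P.τ n) σ ξ k).point with hY
    have hYM : Y ∈ M.carrier := innerState_point_mem hσ ξ k
    set V := M.toRiemannian Y (svrgGradient f σ.point Y (ξ k)) with hV
    have h1 : ‖V‖ ≤ 3 * P.C / P.ν := by
      refine (M.norm_toRiemannian_le hν hYM (h.metric_ge Y hYM) _).trans ?_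
      gcongr
      exact h.norm_svrgGradient_le hP.C_nonneg hσ hYM (ξ k)
    have h2 := (h.retraction Y hYM (-V) (neg_mem (M.toRiemannian_mem hYM _)) (P.τ n)
      ⟨hτ.le, hP.τ_le_T hn⟩).1
    rw [smul_neg, norm_neg] at h2
    have h3 : P.L₁ * P.τ n * ‖V‖ ≤ P.L₁ * P.τ n * (3 * P.C / P.ν) := by gcongr
    change ‖R.toFun Y (-(P.τ n • V)) - σ.point‖ ≤ _
    have h4 := norm_sub_le_norm_sub_add_norm_sub (R.toFun Y (-(P.τ n • V))) Y σ.point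
    push_cast
    linarith

variable [NeZero n]

/-- The potential at the inner iteration `k` of the epoch `s`, summed over all samples. -/
noncomputable def potential (P : Constants) (M : RiemannianSubmanifold d r) (R : Retraction M)
    (f : Fin n → Mat d r → ℝ) (X₀ : Mat d r) (S s k : ℕ) : ℝ :=
  ∑ w : Samples S (P.K n) (P.B n) n,
    (objective f (iterate M R f (P.τ n) (P.K n) X₀ w.batch s k)
      + P.weight n k * ‖iterate M R f (P.τ n) (P.K n) X₀ w.batch s k
          - iterate M R f (P.τ n) (P.K n) X₀ w.batch s 0‖ ^ 2)

/-- The squared norm of the Riemannian gradient at the inner iteration `k` of the epoch `s`, summed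
over all samples. -/
noncomputable def gradSq (P : Constants) (M : RiemannianSubmanifold d r) (R : Retraction M)
    (f : Fin n → Mat d r → ℝ) (X₀ : Mat d r) (S s k : ℕ) : ℝ :=
  ∑ w : Samples S (P.K n) (P.B n) n,
    ‖M.grad (objective f) (iterate M R f (P.τ n) (P.K n) X₀ w.batch s k)‖ ^ 2

/-- This is the conditional expectation given all mini-batches except the one at `(s, k)`: the
reference point and `X^{s,k}` depend only on earlier ones, so on each fibre of the resampling the
one-step estimate applies. -/
theorem potential_succ_le (h : Admissible P M R f) (hP : P.Valid) (hX₀ : X₀ ∈ M.carrier)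
    {S : ℕ} (s : Fin S) (k : Fin (P.K n)) :
    potential P M R f X₀ S s (k + 1)
      ≤ potential P M R f X₀ S s k - P.ν * P.τ n / 2 * gradSq P M R f X₀ S s k := by
  have hn : 0 < n := NeZero.pos n
  rw [potential, potential, gradSq, Finset.mul_sum, ← Finset.sum_sub_distrib]
  refine sum_le_sum_of_resample (fun w => w s k) (Samples.update s k)
    (fun w x => by simp [Samples.update]) (fun w x y => by simp [Samples.update])
    (fun w => by simp [Samples.update]) fun w => ?_
  set σ := outerState M R f (P.τ n) (P.K n) X₀ w.batch s with hσ
  have hσM : σ.point ∈ M.carrier := outerState_point_mem hX₀ _ _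
  set X := (innerState M R f (P.τ n) σ (w.batch s) k).point with hX
  have hXM : X ∈ M.carrier := innerState_point_mem hσM _ _
  have hout : ∀ ξ, outerState M R f (P.τ n) (P.K n) X₀ (Samples.update s k w ξ).batch s = σ :=
    fun ξ => outerState_congr X₀ fun i hi j _ => Samples.batch_update_of_ne w ξ (Or.inl hi.ne)
  have hinn : ∀ ξ, innerState M R f (P.τ n) σ ((Samples.update s k w ξ).batch s) k
      = innerState M R f (P.τ n) σ (w.batch s) k :=
    fun ξ => innerState_congr σ fun j hj => Samples.batch_update_of_ne w ξ (Or.inr hj.ne)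
  have hzero : ∀ ξ, iterate M R f (P.τ n) (P.K n) X₀ (Samples.update s k w ξ).batch s 0
      = σ.point := by
    intro ξ
    rw [iterate, hout]
    rfl
  have hk : ∀ ξ, iterate M R f (P.τ n) (P.K n) X₀ (Samples.update s k w ξ).batch s k = X := by
    intro ξ
    rw [iterate, hout, hinn]
  have hsucc : ∀ ξ, iterate M R f (P.τ n) (P.K n) X₀ (Samples.update s k w ξ).batch s (k + 1)
      = R.toFun X (-(P.τ n • M.toRiemannian X (svrgGradient f σ.point X ξ))) := by
    intro ξ
    rw [iterate, hout]
    simp only [innerState]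
    rw [hinn, Samples.batch_update_self]
  simp only [hzero, hk, hsucc]
  have hρ : ‖X - σ.point‖ ≤ P.radius n := by
    refine (h.norm_innerState_sub_le hP hn hσM _ _).trans ?_
    have h1 := hP.τ_pos hn
    have h2 := hP.ν_pos
    have h3 := hP.C_nonneg
    have h4 := one_pos.trans_le hP.one_le_L₁
    rw [Constants.radius]
    gcongr
    exact k.2.le
  exact h.sum_potential_step_le hP.L_pos hP.C_nonneg hP.L₂_pos hP.ν_pos (hP.B_pos hn) hσM hXM
    (hP.τ_pos hn) (hP.τ_le_T hn) (hP.weight_nonneg n (k + 1)) (hP.β_pos hn) hρ rfl rfl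
    (hP.weight_step hn k.2) (hP.decrease_le hn k)

/-- The expected squared gradient norms of all iterates are summable, up to the optimality gap. -/
theorem sum_gradSq_le (h : Admissible P M R f) (hP : P.Valid) (hX₀ : X₀ ∈ M.carrier) {D : ℝ}
    (hD : ∀ X ∈ M.carrier, objective f X₀ - objective f X ≤ D) (S : ℕ) :
    P.ν * P.τ n / 2 * ∑ s ∈ Finset.range S, ∑ k ∈ Finset.range (P.K n), gradSq P M R f X₀ S s k
      ≤ Fintype.card (Samples S (P.K n) (P.B n) n) * D := by
  let F : ℕ → ℝ := fun s => ∑ w : Samples S (P.K n) (P.B n) n,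
    objective f (outerState M R f (P.τ n) (P.K n) X₀ w.batch s).point
  -- At `k = 0` the distance is zero and at `k = K` the weight is zero, so at both ends of an epoch
  -- the potential is the bare objective.
  have hF₀ : ∀ s, potential P M R f X₀ S s 0 = F s := by
    intro s
    simp [potential, F, iterate, innerState]
  have hF₁ : ∀ s, potential P M R f X₀ S s (P.K n) = F (s + 1) := by
    intro s
    simp [potential, F, iterate, outerState, Valid.weight_self]
  have hepoch : ∀ s ∈ Finset.range S,
      P.ν * P.τ n / 2 * ∑ k ∈ Finset.range (P.K n), gradSq P M R f X₀ S s k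
        ≤ F s - F (s + 1) := by
    intro s hs
    rw [← hF₀, ← hF₁, Finset.mul_sum, ← Finset.sum_range_sub' (potential P M R f X₀ S s)]
    refine Finset.sum_le_sum fun k hk => ?_
    have := h.potential_succ_le hP hX₀ ⟨s, Finset.mem_range.1 hs⟩ ⟨k, Finset.mem_range.1 hk⟩
    simp only at this
    linarith
  rw [Finset.mul_sum]
  refine (Finset.sum_le_sum hepoch).trans ?_
  rw [Finset.sum_range_sub', ← Finset.sum_sub_distrib]
  calc _ ≤ ∑ _w : Samples S (P.K n) (P.B n) n, D :=
        Finset.sum_le_sum fun w _ => hD _ (outerState_point_mem hX₀ _ _)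
    _ = _ := by simp

/-- The constant `4` combines `p_k ≤ 2/K` with the decrease `ντ/2` per iteration. -/
theorem outputExpectation_le (h : Admissible P M R f) (hP : P.Valid) (hX₀ : X₀ ∈ M.carrier) {D : ℝ}
    (hD : ∀ X ∈ M.carrier, objective f X₀ - objective f X ≤ D) {S : ℕ} (hS : 0 < S) :
    outputExpectation M R f (P.τ n) S (P.K n) (P.B n) (P.p n) X₀
        (fun X => ‖M.grad (objective f) X‖ ^ 2)
      ≤ 4 * D / (P.ν * (P.K n * P.τ n) * S) := by
  have hn : 0 < n := NeZero.pos n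
  have hK := one_pos.trans_le (hP.one_le_K hn)
  have hτ := hP.τ_pos hn
  have hν := hP.ν_pos
  have hS' : (0 : ℝ) < S := by exact_mod_cast hS
  have hN : (0 : ℝ) < Fintype.card (Samples S (P.K n) (P.B n) n) := by
    exact_mod_cast Fintype.card_pos
  have h1 : ∑ w : Samples S (P.K n) (P.B n) n, ∑ s : Fin S, ∑ k : Fin (P.K n + 1), P.p n k *
      ‖M.grad (objective f) (iterate M R f (P.τ n) (P.K n) X₀ w.batch s k)‖ ^ 2
      ≤ 2 / P.K n * ∑ s ∈ Finset.range S, ∑ k ∈ Finset.range (P.K n),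
          gradSq P M R f X₀ S s k := by
    rw [Finset.sum_comm, Finset.mul_sum, Finset.sum_range]
    refine Finset.sum_le_sum fun s _ => ?_
    rw [Finset.sum_comm, Finset.mul_sum, Finset.sum_range, Fin.sum_univ_castSucc]
    simp only [Fin.val_castSucc, Fin.val_last]
    have h0 : P.p n (P.K n) = 0 := if_neg (lt_irrefl _)
    simp only [h0, zero_mul, Finset.sum_const_zero, add_zero]
    refine Finset.sum_le_sum fun k _ => ?_
    rw [← Finset.mul_sum]
    exact mul_le_mul_of_nonneg_right (hP.p_le hn k) (Finset.sum_nonneg fun w _ => sq_nonneg _)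
  have h2 := h.sum_gradSq_le hP hX₀ hD S
  set G := ∑ s ∈ Finset.range S, ∑ k ∈ Finset.range (P.K n), gradSq P M R f X₀ S s k
  set N := (Fintype.card (Samples S (P.K n) (P.B n) n) : ℝ)
  have h3 : G ≤ N * D / (P.ν * P.τ n / 2) := by
    rw [le_div_iff₀ (by positivity)]
    linarith
  rw [outputExpectation, ← Finset.sum_div]
  calc _ ≤ 2 / P.K n * (N * D / (P.ν * P.τ n / 2)) / S / N := by
        gcongr
        exact h1.trans (mul_le_mul_of_nonneg_left h3 (by positivity))
    _ = _ := by
        field_simp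
        ring

end Admissible

/-! ### Number of epochs and complexity. -/

namespace Constants.Valid

variable {P : Constants} {n : ℕ}

theorem one_sub_μ_pos (h : P.Valid) : 0 < 1 - P.μ := by linarith [h.μ_le]

theorem exponent_pos (h : P.Valid) : 0 < 1 / (3 * (1 - P.μ)) := by
  have := h.one_sub_μ_pos
  positivity

theorem K_mul_τ (h : P.Valid) (hn : 0 < n) : P.K n * P.τ n = P.b * (P.K n : ℝ) ^ (1 - P.μ) := by
  have hK := one_pos.trans_le (h.one_le_K hn)
  rw [τ_eq, Real.rpow_sub hK, Real.rpow_one]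
  ring

theorem le_K_rpow (h : P.Valid) (n : ℕ) :
    P.κ ^ (1 / 3 : ℝ) * (n : ℝ) ^ (1 / 3 : ℝ) ≤ (P.K n : ℝ) ^ (1 - P.μ) := by
  have hκ := h.κ_pos
  have hμ := h.one_sub_μ_pos
  rw [← Real.mul_rpow hκ.le (Nat.cast_nonneg n)]
  calc (P.κ * n) ^ (1 / 3 : ℝ) = ((P.κ * n) ^ (1 / (3 * (1 - P.μ)))) ^ (1 - P.μ) := by
        rw [← Real.rpow_mul (by positivity)]
        congr 1
        field_simp
    _ ≤ _ := by
        gcongr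
        exact Nat.le_ceil _

theorem K_le (h : P.Valid) (hn : 0 < n) :
    (P.K n : ℝ) ≤ (P.κ ^ (1 / (3 * (1 - P.μ))) + 1) * (n : ℝ) ^ (1 / (3 * (1 - P.μ))) := by
  have hκ := h.κ_pos
  have hn' : (1 : ℝ) ≤ n := by exact_mod_cast hn
  have h1 := (Nat.ceil_lt_add_one
    (Real.rpow_nonneg (by positivity : 0 ≤ P.κ * n) (1 / (3 * (1 - P.μ))))).le
  have h2 := Real.one_le_rpow hn' h.exponent_pos.le
  rw [Real.mul_rpow hκ.le (Nat.cast_nonneg n)] at h1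
  rw [K, Real.mul_rpow hκ.le (Nat.cast_nonneg n)]
  linarith

theorem B_mul_K_le (h : P.Valid) (hn : 0 < n) :
    (P.B n : ℝ) * P.K n ≤ 2 * (P.κ ^ (1 / (3 * (1 - P.μ))) + 1) ^ (3 * (1 - P.μ)) * n := by
  have hK := h.one_le_K hn
  have hK₀ := one_pos.trans_le hK
  have hμ := h.one_sub_μ_pos
  have hμ' := h.μ_le
  have hκ := h.κ_pos
  have h1 : (P.B n : ℝ) ≤ 2 * (P.K n : ℝ) ^ (2 - 3 * P.μ) := by
    have h2 := (Nat.ceil_lt_add_one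
      (Real.rpow_nonneg (Nat.cast_nonneg (P.K n)) (2 - 3 * P.μ))).le
    -- Since `μ ≤ 2/3`, the power is at least `1`, so the ceiling at most doubles it.
    have h3 := Real.one_le_rpow hK (show 0 ≤ 2 - 3 * P.μ by linarith)
    rw [B]
    linarith
  calc (P.B n : ℝ) * P.K n ≤ 2 * (P.K n : ℝ) ^ (2 - 3 * P.μ) * P.K n := by gcongr
    _ = 2 * (P.K n : ℝ) ^ (3 * (1 - P.μ)) := by
        rw [mul_assoc, ← Real.rpow_add_one hK₀.ne']
        congr 2
        ring
    _ ≤ 2 * ((P.κ ^ (1 / (3 * (1 - P.μ))) + 1) * (n : ℝ) ^ (1 / (3 * (1 - P.μ))))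
          ^ (3 * (1 - P.μ)) := by
        gcongr
        exact h.K_le hn
    _ = _ := by
        rw [Real.mul_rpow (by positivity) (by positivity), ← Real.rpow_mul (Nat.cast_nonneg n),
          one_div_mul_cancel (by positivity), Real.rpow_one]
        ring

theorem K_rpow_μ_le (h : P.Valid) (hn : 0 < n) :
    (P.K n : ℝ) ^ P.μ ≤
      (P.κ ^ (1 / (3 * (1 - P.μ))) + 1) * (n : ℝ) ^ (P.μ / (3 * (1 - P.μ))) := by
  have hκ := h.κ_pos
  have hμ := h.μ_nonneg
  have hμ' := h.μ_le
  calc (P.K n : ℝ) ^ P.μ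
      ≤ ((P.κ ^ (1 / (3 * (1 - P.μ))) + 1) * (n : ℝ) ^ (1 / (3 * (1 - P.μ)))) ^ P.μ := by
        gcongr
        exact h.K_le hn
    _ = (P.κ ^ (1 / (3 * (1 - P.μ))) + 1) ^ P.μ * (n : ℝ) ^ (P.μ / (3 * (1 - P.μ))) := by
        rw [Real.mul_rpow (by positivity) (by positivity), ← Real.rpow_mul (Nat.cast_nonneg n),
          one_div_mul_eq_div]
    _ ≤ _ := by
        gcongr
        refine (Real.rpow_le_rpow_of_exponent_le ?_ (show P.μ ≤ 1 by linarith)).trans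
          (Real.rpow_one _).le
        linarith [Real.rpow_nonneg hκ.le (1 / (3 * (1 - P.μ)))]

/-- The number of epochs can be chosen so that the output is `ε`-stationary, at the stated cost. -/
theorem exists_complexity (h : P.Valid) {D : ℝ} (hD : 0 ≤ D) :
    ∃ A : ℝ, 0 < A ∧ ∀ n : ℕ, 0 < n → ∀ ε : ℝ, 0 < ε → ∃ S : ℕ, 0 < S ∧
      4 * D / (P.ν * (P.K n * P.τ n) * S) ≤ ε ∧
      (S * (n + P.K n * (2 * P.B n)) : ℝ) ≤ A * ((n : ℝ) ^ (2 / 3 : ℝ) / ε + n) ∧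
      (S * P.K n : ℝ) ≤ A * ((n : ℝ) ^ (P.μ / (3 * (1 - P.μ))) / ε
        + (n : ℝ) ^ (1 / (3 * (1 - P.μ)))) := by
  have hκ := h.κ_pos
  have hν := h.ν_pos
  have hb := h.b_pos
  set C₁ := P.κ ^ (1 / (3 * (1 - P.μ))) + 1 with hC₁
  have hC₁pos : 0 < C₁ := by positivity
  set C₂ := 1 + 4 * C₁ ^ (3 * (1 - P.μ)) with hC₂
  have hC₂pos : 0 < C₂ := by positivity
  set E := 4 * D / (P.ν * P.b) with hE
  have hE₀ : 0 ≤ E := by positivity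
  have hk := Real.rpow_pos_of_pos hκ (1 / 3)
  -- The first summand serves the IFO bound and the second the RO bound, so that one `A` works for
  -- both.
  refine ⟨(E / P.κ ^ (1 / 3 : ℝ) + 2) * C₂ + (E + 2) * C₁, by positivity, fun n hn ε hε => ?_⟩
  have hn' : (0 : ℝ) < n := by exact_mod_cast hn
  have hK := one_pos.trans_le (h.one_le_K hn)
  have hτ := h.τ_pos hn
  have hx₀ : 0 ≤ 4 * D / (P.ν * (P.K n * P.τ n) * ε) := by positivity
  -- The added `1` keeps `S` positive when `D = 0`; with the ceiling it accounts for the `+ 2` in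
  -- `hSle`.
  refine ⟨⌈4 * D / (P.ν * (P.K n * P.τ n) * ε)⌉₊ + 1, Nat.succ_pos _, ?_, ?_⟩
  · have h1 := Nat.le_ceil (4 * D / (P.ν * (P.K n * P.τ n) * ε))
    rw [div_le_iff₀ (by positivity)] at h1 ⊢
    push_cast
    have h2 : 0 ≤ P.ν * (P.K n * P.τ n) * ε := by positivity
    linarith
  set S := ⌈4 * D / (P.ν * (P.K n * P.τ n) * ε)⌉₊ + 1 with hS
  have hSle : (S : ℝ) ≤ E / ((P.K n : ℝ) ^ (1 - P.μ) * ε) + 2 := by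
    have h1 := (Nat.ceil_lt_add_one hx₀).le
    have h2 : 4 * D / (P.ν * (P.K n * P.τ n) * ε) = E / ((P.K n : ℝ) ^ (1 - P.μ) * ε) := by
      rw [h.K_mul_τ hn, hE, div_div]
      congr 1
      ring
    rw [hS]
    push_cast
    linarith
  constructor
  · have h1 : (n + P.K n * (2 * P.B n) : ℝ) ≤ C₂ * n := by
      have := h.B_mul_K_le hn
      rw [hC₂]
      linarith
    have h2 : (S : ℝ) ≤ E / P.κ ^ (1 / 3 : ℝ) / ((n : ℝ) ^ (1 / 3 : ℝ) * ε) + 2 := by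
      refine hSle.trans ?_
      have h3 := h.le_K_rpow n
      have h4 := Real.rpow_pos_of_pos hn' (1 / 3)
      rw [div_div E (P.κ ^ (1 / 3 : ℝ)), ← mul_assoc]
      gcongr
    have h3 : (n : ℝ) = (n : ℝ) ^ (2 / 3 : ℝ) * (n : ℝ) ^ (1 / 3 : ℝ) := by
      rw [← Real.rpow_add hn']
      norm_num
    have h4 := Real.rpow_pos_of_pos hn' (1 / 3)
    have h5 := Real.rpow_pos_of_pos hn' (2 / 3)
    calc (S * (n + P.K n * (2 * P.B n)) : ℝ)
        ≤ (E / P.κ ^ (1 / 3 : ℝ) / ((n : ℝ) ^ (1 / 3 : ℝ) * ε) + 2) * (C₂ * n) := by gcongr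
      _ = E / P.κ ^ (1 / 3 : ℝ) * C₂ * ((n : ℝ) / (n : ℝ) ^ (1 / 3 : ℝ) / ε) + 2 * C₂ * n := by
          field_simp
      _ = E / P.κ ^ (1 / 3 : ℝ) * C₂ * ((n : ℝ) ^ (2 / 3 : ℝ) / ε) + 2 * C₂ * n := by
          rw [← eq_div_of_mul_eq h4.ne' h3.symm]
      _ ≤ _ := by
          have h6 : 0 ≤ E / P.κ ^ (1 / 3 : ℝ) * C₂ * n := by positivity
          have h7 : 0 ≤ 2 * C₂ * ((n : ℝ) ^ (2 / 3 : ℝ) / ε) := by positivity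
          have h8 : 0 ≤ (E + 2) * C₁ * ((n : ℝ) ^ (2 / 3 : ℝ) / ε + n) := by positivity
          linarith
  · have h1 := h.K_le hn
    have h2 := h.K_rpow_μ_le hn
    rw [← hC₁] at h1 h2
    have h3 : (P.K n : ℝ) / (P.K n : ℝ) ^ (1 - P.μ) = (P.K n : ℝ) ^ P.μ := by
      rw [Real.rpow_sub hK, Real.rpow_one]
      field_simp
    calc (S * P.K n : ℝ) ≤ (E / ((P.K n : ℝ) ^ (1 - P.μ) * ε) + 2) * P.K n := by gcongr
      _ = E * ((P.K n : ℝ) / (P.K n : ℝ) ^ (1 - P.μ) / ε) + 2 * P.K n := by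
          field_simp
      _ ≤ E * (C₁ * (n : ℝ) ^ (P.μ / (3 * (1 - P.μ))) / ε)
            + 2 * (C₁ * (n : ℝ) ^ (1 / (3 * (1 - P.μ)))) := by
          rw [h3]
          gcongr
      _ ≤ _ := by
          have h5 : 0 ≤ (n : ℝ) ^ (P.μ / (3 * (1 - P.μ))) / ε := by positivity
          have h6 : 0 ≤ (n : ℝ) ^ (1 / (3 * (1 - P.μ))) := by positivity
          have h7 := mul_nonneg (by positivity : 0 ≤ E * C₁) h6
          have h8 := mul_nonneg (by positivity : 0 ≤ 2 * C₁) h5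
          have h9 := mul_nonneg (by positivity : 0 ≤ (E / P.κ ^ (1 / 3 : ℝ) + 2) * C₂)
            (add_nonneg h5 h6)
          rw [mul_div_assoc]
          linarith

end Constants.Valid

end SSVRG

theorem mainTheorem3 (P : SSVRG.Constants) (D : ℝ)
    (hL : 0 < P.L) (hC : 0 ≤ P.C) (hL₁ : 1 ≤ P.L₁) (hL₂ : 0 < P.L₂) (hT : 0 < P.T)
    (hν : 0 < P.ν) (hμ₀ : 0 ≤ P.μ) (hμ₁ : P.μ ≤ 2 / 3) (hκ : 0 < P.κ)
    (hc₀ : 0 < P.c) (hc₁ : P.c < 1)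
    (hc : P.Lhat / (√P.Ltilde * P.L) * Real.exp (P.c ^ 2 + 2 * P.c) * P.c ≤ 1) :
    ∃ A : ℝ, 0 < A ∧ ∀ (n : ℕ) [NeZero n] (ε : ℝ), 0 < ε → ∃ S : ℕ, 0 < S ∧
      -- the probabilities of the algorithm are well defined
      (∀ k, 0 ≤ P.p n k) ∧ ∑ k ∈ Finset.range (P.K n + 1), P.p n k = 1 ∧
      ∀ (d r : ℕ) (M : SSVRG.RiemannianSubmanifold d r) (R : SSVRG.Retraction M)
        (f : Fin n → SSVRG.Mat d r → ℝ) (X₀ : SSVRG.Mat d r) (γ : ℝ),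
        -- the metric is equivalent to the Frobenius one
        (∀ X ∈ M.carrier, ∀ E ∈ M.tangent X,
          P.ν * ‖E‖ ^ 2 ≤ M.metric X E E ∧ M.metric X E E ≤ γ * ‖E‖ ^ 2) →
        -- the retraction bounds
        (∀ X ∈ M.carrier, ∀ E ∈ M.tangent X, ∀ t ∈ Set.Icc 0 P.T,
          ‖R.toFun X (t • E) - X‖ ≤ P.L₁ * t * ‖E‖ ∧
          ‖R.toFun X (t • E) - X - t • E‖ ≤ P.L₂ * t ^ 2 * ‖E‖ ^ 2) →
        -- smoothness of the components
        (∀ i, ∀ X ∈ convexHull ℝ M.carrier, DifferentiableAt ℝ (f i) X) →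
        (∀ i, ∀ X ∈ convexHull ℝ M.carrier, ∀ Y ∈ convexHull ℝ M.carrier,
          ‖gradient (f i) X - gradient (f i) Y‖ ≤ P.L * ‖X - Y‖) →
        -- boundedness of the component gradients on the manifold
        (∀ i, ∀ X ∈ M.carrier, ‖gradient (f i) X‖ ≤ P.C) →
        -- the initial point and its optimality gap
        X₀ ∈ M.carrier →
        (∀ X ∈ M.carrier, SSVRG.objective f X₀ - SSVRG.objective f X ≤ D) →
        -- the output is a stochastic `ε`-stationary point
        SSVRG.outputExpectation M R f (P.τ n) S (P.K n) (P.B n) (P.p n) X₀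
            (fun X => ‖M.grad (SSVRG.objective f) X‖ ^ 2) ≤ ε ∧
        -- the numbers of oracle calls of every run
        ∀ w : SSVRG.Samples S (P.K n) (P.B n) n,
          ((SSVRG.outerState M R f (P.τ n) (P.K n) X₀ w.batch S).ifo : ℝ)
              ≤ A * ((n : ℝ) ^ (2 / 3 : ℝ) / ε + n) ∧
          ((SSVRG.outerState M R f (P.τ n) (P.K n) X₀ w.batch S).ro : ℝ)
              ≤ A * ((n : ℝ) ^ (P.μ / (3 * (1 - P.μ))) / ε
                  + (n : ℝ) ^ (1 / (3 * (1 - P.μ)))) ∧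
          (P.μ = 0 →
            ((SSVRG.outerState M R f (P.τ n) (P.K n) X₀ w.batch S).ro : ℝ)
              ≤ A * (1 / ε + (n : ℝ) ^ (1 / 3 : ℝ))) := by
  have hP : P.Valid := ⟨hL, hC, hL₁, hL₂, hT, hν, hμ₀, hμ₁, hκ, hc₀, hc₁, hc⟩
  -- `D ≥ 0` would follow from the gap condition at `X₀`, but `A` is chosen before any problem data
  -- are given, hence `max D 0`.
  obtain ⟨A, hA, h⟩ := hP.exists_complexity (le_max_right D 0)
  refine ⟨A, hA, fun n _ ε hε => ?_⟩
  have hn : 0 < n := NeZero.pos n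
  obtain ⟨S, hS, hSε, hifo, hro⟩ := h n hn ε hε
  refine ⟨S, hS, hP.p_nonneg hn, hP.sum_p hn, ?_⟩
  intro d r M R f X₀ γ hmetric hR hdiff hlip hbdd hX₀ hD
  have hadm : SSVRG.Admissible P M R f :=
    ⟨fun X hX E hE => (hmetric X hX E hE).1, hR, hdiff, hlip, hbdd⟩
  refine ⟨(hadm.outputExpectation_le hP hX₀
    (fun X hX => (hD X hX).trans (le_max_left D 0)) hS).trans hSε, fun w => ?_⟩
  obtain ⟨h1, h2⟩ := SSVRG.outerState_calls (M := M) (R := R) (f := f) (τ := P.τ n)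
    (K := P.K n) X₀ w.batch S
  rw [h1, h2]
  push_cast
  refine ⟨hifo, hro, fun hμ => ?_⟩
  simpa [hμ] using hro
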